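/- Let $n,k$ be positive integers and put $[m]=\{1,\dots,m\}$. A partition of a finite linearly ordered set is noncrossing if there are no $a<b<c<d$ with $a,c$ in one block and $b,d$ in a different block. Let $NC(m)$ be the poset of noncrossing partitions of $[m]$ ordered by refinement ($P\le Q$ if each block of $P$ lies in a block of $Q$), and let $NC^{(k)}(n)$ be the induced subposet of $NC(kn)$ of partitions all of whose blocks have cardinality divisible by $k$. For partitions $Q_1,\dots,Q_k$ of $[n]$, the shuffle $\langle Q_1,\dots,Q_k\rangle=\bigcup_{i=1}^k\big(kQ_i-(k-i)\big)$ is the partition of $[kn]$ whose restriction to $\{i,k+i,\dots,(n-1)k+i\}$ is the copy of $Q_i$ under $x\mapsto kx-(k-i)$, with different residue classes mod $k$ not joined. For $P\in NC(m)$ the Kreweras complement $K(P)$ is the coarsest partition $Q$ of $[m]$ such that $\langle P,Q\rangle$ is a noncrossing partition of $[2m]$; $K$ is a bijection of $NC(m)$. For $P\le N$ in $NC(m)$, the relative Kreweras complement is $K^N(P)=\bigcup_{B\in N}K_B(P|_B)$, where $P|_B$ is the restriction of $P$ to the block $B$ of $N$ and $K_B$ is the Kreweras complement for the linearly ordered set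 $B$. For a $k$-multichain $P_1\le\cdots\le P_k$ in $NC(n)$ put $$\partial(P_1,\dots,P_k)=\big(K^{P_2}(P_1),\dots,K^{P_k}(P_{k-1}),K(P_k)\big).$$ Let $A_{n-1}$ be the symmetric group on $[n]$, $\ell_T$ the word length with respect to all transpositions, $\pi\le_T\mu$ the relation $\ell_T(\mu)=\ell_T(\pi)+\ell_T(\pi^{-1}\mu)$, $c=(1\,2\cdots n)$, and $NC(A_{n-1})=\{w:1\le_T w\le_T c\}$. Let $NC^{(k)}(A_{n-1})$ be the set of $k$-multichains $(\pi)_k=(\pi_1\le_T\cdots\le_T\pi_k)$ in $NC(A_{n-1})$, ordered by $(\pi)_k\le(\mu)_k$ if and only if $\mu_i^{-1}\mu_{i+1}\le_T\pi_i^{-1}\pi_{i+1}$ for all $1\le i\le k$, where $\pi_{k+1}=\mu_{k+1}=c$. For a permutation $\pi$ let $\{\pi\}$ be the partition of $[n]$ into orbits of $\pi$. Then the following hold. 1. For every $(\pi)_k\in NC^{(k)}(A_{n-1})$ the sequence $(\{\pi_1\},\dots,\{\pi_k\})$ is a $k$-multichain in $NC(n)$, and $$\big(\{\pi_1^{-1}\pi_2\},\dots,\{\pi_{k-1}^{-1}\pi_k\},\{\pi_k^{-1}c\}\big)=\partial(\{\pi_1\},\dots,\{\pi_k\}).$$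 2. For every $(\pi)_k\in NC^{(k)}(A_{n-1})$ the shuffle $\langle\partial(\{\pi_1\},\dots,\{\pi_k\})\rangle$ is noncrossing, and the map $$(\pi_1,\dots,\pi_k)\longmapsto K^{-1}\Big\langle K^{\{\pi_2\}}(\{\pi_1\}),\dots,K^{\{\pi_k\}}(\{\pi_{k-1}\}),K(\{\pi_k\})\Big\rangle,$$ where $K$ is the Kreweras complement on $NC(kn)$, is an isomorphism of posets from $NC^{(k)}(A_{n-1})$ to $NC^{(k)}(n)$. 3. For every $k$-multichain $(P_1,\dots,P_k)$ in $NC(n)$ the shuffle $\langle\partial(P_1,\dots,P_k)\rangle$ is noncrossing, and $(P_1,\dots,P_k)\mapsto K^{-1}\langle\partial(P_1,\dots,P_k)\rangle$ is a bijection from the $k$-multichains in $NC(n)$ to $NC^{(k)}(n)$. -/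

import Mathlib

namespace KDivNC

/-! ## Set partitions

A set partition of `α` is a `Setoid α`; its blocks are `Setoid.classes`, and the lattice order on
`Setoid α` is refinement (`P ≤ Q` iff every block of `P` lies in a block of `Q`). The set
`[n] = {1, …, n}` is `Fin n`, with the vertex `v` of `[n]` written as `v - 1`. -/

/-- A partition of a linearly ordered set is noncrossing if `a < b < c < d` with `a, c` in one block
and `b, d` in one block only occurs when all four lie in the same block. -/
def IsNoncrossing {α : Type*} [LinearOrder α] (P : Setoid α) : Prop :=
  ∀ a b c d : α, a < b → b < c → c < d → P a c → P b d → P a b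

/-- The poset `NC(n)` of noncrossing partitions of `[n]`, ordered by refinement. -/
abbrev NC (n : ℕ) : Type := {P : Setoid (Fin n) // IsNoncrossing P}

/-- The shuffle of a sequence `(Q_0, …, Q_{k-1})` of partitions of a linear order `α`, as a partition
of `α × {0, …, k-1}` in lexicographic order: the copy `α × {i}` is partitioned by `Q_i`, and
different copies are not joined. -/
def shuffleLex {α : Type*} {k : ℕ} (Q : Fin k → Setoid α) : Setoid (α ×ₗ Fin k) where
  r a b := (ofLex a).2 = (ofLex b).2 ∧ Q (ofLex a).2 (ofLex a).1 (ofLex b).1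
  iseqv :=
    { refl := fun a => ⟨rfl, (Q _).refl' _⟩
      symm := fun {a b} h => ⟨h.1.symm, by rw [← h.1]; exact (Q _).symm' h.2⟩
      trans := fun {a b c} h h' => ⟨h.1.trans h'.1, (Q _).trans' h.2 (by rw [h.1]; exact h'.2)⟩ }

/-- The shuffle partition `⟨Q_1, …, Q_k⟩ = ⋃ i, (k Q_i - (k - i))` of `[kn]`. With all indices
shifted to start at zero, the entry `x` of `Q_i` is placed at the position `k * x + i`. -/
def shuffle {n k : ℕ} (Q : Fin k → Setoid (Fin n)) : Setoid (Fin (n * k)) :=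
  (shuffleLex Q).comap fun a => toLex (a.divNat, a.modNat)

/-- The interleaving `⟨P, Q⟩` of two partitions. -/
def interleave {α : Type*} (P Q : Setoid α) : Setoid (α ×ₗ Fin 2) := shuffleLex ![P, Q]

/-! ## The Kreweras complement -/

/-- The Kreweras complement `K(P)` of a noncrossing partition: the coarsest partition `Q` such that
`⟨P, Q⟩` is noncrossing (see `isGreatest_kreweras`). -/
def kreweras {α : Type*} [LinearOrder α] (P : Setoid α) : Setoid α :=
  sSup {Q | IsNoncrossing (interleave P Q)}

/-- Auxiliary explicit description of the Kreweras complement: `x` and `y` are joined if the interval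
between them is a union of blocks of `P`. -/
def krewerasAux {α : Type*} [LinearOrder α] (P : Setoid α) : Setoid α where
  r x y := ∀ p q, P p q → ((x < p ↔ y < p) ↔ (x < q ↔ y < q))
  iseqv :=
    { refl := fun x p q _ => by simp
      symm := fun {x y} h p q hpq => by have := h p q hpq; tauto
      trans := fun {x y z} h h' p q hpq => by
        have h1 := h p q hpq
        have h2 := h' p q hpq
        tauto }

theorem krewerasAux_apply {α : Type*} [LinearOrder α] (P : Setoid α) (x y : α) :
    krewerasAux P x y ↔ ∀ p q, P p q → ((x < p ↔ y < p) ↔ (x < q ↔ y < q)) := Iff.rfl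

theorem interleave_apply {α : Type*} (P Q : Setoid α) (x y : α) (i j : Fin 2) :
    interleave P Q (toLex (x, i)) (toLex (y, j)) ↔
      (i = 0 ∧ j = 0 ∧ P x y) ∨ (i = 1 ∧ j = 1 ∧ Q x y) := by
  change (i = j ∧ (![P, Q] i) x y) ↔ _
  have h01 : ∀ i : Fin 2, i = 0 ∨ i = 1 := by decide
  rcases h01 i with rfl | rfl <;> rcases h01 j with rfl | rfl <;> simp <;> rfl

theorem le_krewerasAux {α : Type*} [LinearOrder α] {P Q : Setoid α}
    (h : IsNoncrossing (interleave P Q)) : Q ≤ krewerasAux P := by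
  have key : ∀ x y p q, x < y → Q x y → P p q → x < p → p ≤ y → x < q ∧ q ≤ y := by
    intro x y p q hxy hQ hP hp hp'
    by_contra hc
    rcases lt_or_ge x q with hq | hq
    · have hq' : y < q := by
        by_contra h'
        exact hc ⟨hq, not_lt.mp h'⟩
      have := h (toLex (x, 1)) (toLex (p, 0)) (toLex (y, 1)) (toLex (q, 0))
        (by simp [Prod.Lex.toLex_lt_toLex, hp])
        (by rcases hp'.lt_or_eq with h' | h' <;> simp [Prod.Lex.toLex_lt_toLex, h'])
        (by simp [Prod.Lex.toLex_lt_toLex, hq'])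
        (by simpa [interleave_apply] using hQ) (by simpa [interleave_apply] using hP)
      simp [interleave_apply] at this
    · have := h (toLex (q, 0)) (toLex (x, 1)) (toLex (p, 0)) (toLex (y, 1))
        (by rcases hq.lt_or_eq with h' | h' <;> simp [Prod.Lex.toLex_lt_toLex, h'])
        (by simp [Prod.Lex.toLex_lt_toLex, hp])
        (by rcases hp'.lt_or_eq with h' | h' <;> simp [Prod.Lex.toLex_lt_toLex, h'])
        (by simpa [interleave_apply] using P.symm' hP) (by simpa [interleave_apply] using hQ)
      simp [interleave_apply] at this
  have key2 : ∀ x y, x < y → Q x y → krewerasAux P x y := by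
    intro x y hxy hQ p q hpq
    have h1 := key x y p q hxy hQ hpq
    have h2 := key x y q p hxy hQ (P.symm' hpq)
    grind
  intro x y hQ
  rcases lt_trichotomy x y with h' | h' | h'
  · exact key2 x y h' hQ
  · subst h'
    exact (krewerasAux P).refl' x
  · exact (krewerasAux P).symm' (key2 y x h' (Q.symm' hQ))

theorem krewerasAux_isNoncrossing {α : Type*} [LinearOrder α] (P : Setoid α) :
    IsNoncrossing (krewerasAux P) := by
  intro a b c d hab hbc hcd h1 h2 p q hpq
  have h1 := h1 p q hpq
  have h2 := h2 p q hpq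
  grind

theorem interleave_krewerasAux_isNoncrossing {α : Type*} [LinearOrder α] {P : Setoid α}
    (hP : IsNoncrossing P) : IsNoncrossing (interleave P (krewerasAux P)) := by
  have h01 : ∀ i : Fin 2, i = 0 ∨ i = 1 := by decide
  intro a b c d
  induction a using Lex.rec with | _ a
  induction b using Lex.rec with | _ b
  induction c using Lex.rec with | _ c
  induction d using Lex.rec with | _ d
  obtain ⟨a, i⟩ := a
  obtain ⟨b, j⟩ := b
  obtain ⟨c, k⟩ := c
  obtain ⟨d, l⟩ := d
  simp only [interleave_apply, Prod.Lex.toLex_lt_toLex]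
  rintro hab hbc hcd (⟨rfl, rfl, h1⟩ | ⟨rfl, rfl, h1⟩) (⟨rfl, rfl, h2⟩ | ⟨rfl, rfl, h2⟩)
  · left
    simp only [lt_self_iff_false, and_false, or_false] at hab hbc hcd
    exact ⟨rfl, rfl, hP a b c d hab hbc hcd h1 h2⟩
  · exfalso
    have := h2 a c h1
    simp at hab hbc hcd
    grind
  · exfalso
    have := h1 b d h2
    simp at hab hbc hcd
    grind
  · right
    simp only [lt_self_iff_false, and_false, or_false] at hab hbc hcd
    exact ⟨rfl, rfl, krewerasAux_isNoncrossing P a b c d hab hbc hcd h1 h2⟩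

theorem kreweras_eq_aux {α : Type*} [LinearOrder α] {P : Setoid α} (hP : IsNoncrossing P) :
    kreweras P = krewerasAux P :=
  le_antisymm (sSup_le fun _ hQ => le_krewerasAux hQ)
    (le_sSup (interleave_krewerasAux_isNoncrossing hP))

/-- `K(P)` is indeed the coarsest partition `Q` for which `⟨P, Q⟩` is noncrossing. -/
theorem isGreatest_kreweras {α : Type*} [LinearOrder α] {P : Setoid α} (hP : IsNoncrossing P) :
    IsGreatest {Q | IsNoncrossing (interleave P Q)} (kreweras P) := by
  rw [kreweras_eq_aux hP]
  exact ⟨interleave_krewerasAux_isNoncrossing hP, fun _ hQ => le_krewerasAux hQ⟩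

theorem kreweras_isNoncrossing {α : Type*} [LinearOrder α] {P : Setoid α} (hP : IsNoncrossing P) :
    IsNoncrossing (kreweras P) := by
  rw [kreweras_eq_aux hP]
  exact krewerasAux_isNoncrossing P

/-- The Kreweras complement as a map `NC(n) → NC(n)`. -/
def krewerasMap (n : ℕ) (P : NC n) : NC n := ⟨kreweras P.1, kreweras_isNoncrossing P.2⟩

theorem le_of_krewerasAux_le {n : ℕ} {P P' : Setoid (Fin n)} (hP : IsNoncrossing P)
    (h : krewerasAux P ≤ krewerasAux P') : P' ≤ P := by
  classical
  have main : ∀ p q, p < q → P' p q → P p q := by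
    intro p q hpq hP'
    have H : ∀ x y, krewerasAux P x y → p ≤ x → x < q → p ≤ y ∧ y < q := by
      intro x y hxy h1 h2
      have := h hxy p q hP'
      grind
    by_contra hc
    obtain ⟨m, hm, hmax⟩ := (Finset.univ.filter fun z => P p z ∧ z < q).exists_max_image id
      ⟨p, by simp [hpq]⟩
    simp only [Finset.mem_filter, Finset.mem_univ, true_and, id] at hm hmax
    have hpm : p ≤ m := hmax p ⟨P.refl' p, hpq⟩
    have hblock : ∀ z, P p z → z ≤ m ∨ q < z := by
      intro z hz
      rcases lt_trichotomy z q with h' | h' | h'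
      · exact Or.inl (hmax z ⟨hz, h'⟩)
      · exact absurd (h' ▸ hz) hc
      · exact Or.inr h'
    have tr : ∀ {x y z}, P x y → P y z → P x z := fun h h' => P.trans' h h'
    have sy : ∀ {x y}, P x y → P y x := fun h => P.symm' h
    by_cases hex : ∃ z, P p z ∧ q < z
    · obtain ⟨u, hu, hmin⟩ := (Finset.univ.filter fun z => P p z ∧ q < z).exists_min_image id
        (by obtain ⟨z, hz⟩ := hex; exact ⟨z, by simpa using hz⟩)
      simp only [Finset.mem_filter, Finset.mem_univ, true_and, id] at hu hmin
      have hno : ∀ z, m < z → z < u → ¬ P p z := by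
        intro z h1 h2 h3
        rcases hblock z h3 with h' | h'
        · exact absurd h1 (not_lt.mpr h')
        · exact absurd h2 (not_lt.mpr (hmin z ⟨h3, h'⟩))
      have hsat : ∀ s t, P s t → m < s → s < u → m < t ∧ t < u := by
        intro s t hst h1 h2
        have hs := hno s h1 h2
        have htp : ¬ P p t := fun h' => hs (tr h' (sy hst))
        have htm : t ≠ m := by rintro rfl; exact htp hm.1
        have htu : t ≠ u := by rintro rfl; exact htp hu.1
        constructor
        · by_contra h'
          have htm' : t < m := lt_of_le_of_ne (not_lt.mp h') htm
          have := hP t m s u htm' h1 h2 (sy hst) (tr (sy hm.1) hu.1)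
          exact htp (tr hm.1 (sy this))
        · by_contra h'
          have htu' : u < t := lt_of_le_of_ne (not_lt.mp h') htu.symm
          have := hP m s u t h1 h2 htu' (tr (sy hm.1) hu.1) hst
          exact hs (tr hm.1 this)
      have hu0 := u.isLt
      have hqu : q.val < u.val := hu.2
      let v : Fin n := ⟨u.val - 1, by omega⟩
      have hv : ∀ z : Fin n, v < z ↔ ¬ z < u := by
        intro z
        simp only [Fin.lt_def, v]
        omega
      have hrel : krewerasAux P m v := by
        intro s t hst
        have h1 := hsat s t hst
        have h2 := hsat t s (sy hst)
        have h3 : m < u := hm.2.trans hu.2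
        rw [hv, hv]
        grind
      have := (H m v hrel hpm hm.2).2
      simp only [Fin.lt_def, v] at this
      omega
    · have hle : ∀ z, P p z → z ≤ m := by
        intro z hz
        rcases hblock z hz with h' | h'
        · exact h'
        · exact absurd ⟨z, hz, h'⟩ hex
      obtain ⟨i, hi, hmin⟩ := (Finset.univ.filter fun z => P p z).exists_min_image id
        ⟨p, by simp⟩
      simp only [Finset.mem_filter, Finset.mem_univ, true_and, id] at hi hmin
      have hip : i ≤ p := hmin p (P.refl' p)
      have hsat : ∀ s t, P s t → i ≤ s → s ≤ m → i ≤ t ∧ t ≤ m := by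
        intro s t hst h1 h2
        by_cases hs : P p s
        · exact ⟨hmin t (tr hs hst), hle t (tr hs hst)⟩
        · have hsi : i < s := lt_of_le_of_ne h1 (by rintro rfl; exact hs hi)
          have hsm : s < m := lt_of_le_of_ne h2 (by rintro rfl; exact hs hm.1)
          constructor
          · by_contra h'
            have := hP t i s m (not_le.mp h') hsi hsm (sy hst) (tr (sy hi) hm.1)
            exact hs (tr (tr hi (sy this)) (sy hst))
          · by_contra h'
            have := hP i s m t hsi hsm (not_le.mp h') (tr (sy hi) hm.1) hst
            exact hs (tr hi this)
      by_cases hi0 : i.val = 0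
      · have hq0 := q.isLt
        let v : Fin n := ⟨n - 1, by omega⟩
        have hrel : krewerasAux P m v := by
          intro s t hst
          have h1 := hsat s t hst
          have h2 := hsat t s (sy hst)
          have hs := s.isLt
          have ht := t.isLt
          simp only [Fin.lt_def, Fin.le_def, v] at *
          grind
        have := (H m v hrel hpm hm.2).2
        simp only [Fin.lt_def, v] at this
        omega
      · have hi1 := i.isLt
        let v : Fin n := ⟨i.val - 1, by omega⟩
        have hrel : krewerasAux P m v := by
          intro s t hst
          have h1 := hsat s t hst
          have h2 := hsat t s (sy hst)
          simp only [Fin.lt_def, Fin.le_def, v] at *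
          grind
        have := (H m v hrel hpm hm.2).1
        simp only [Fin.le_def, v] at this hip
        omega
  intro p q hpq
  rcases lt_trichotomy p q with h' | h' | h'
  · exact main p q h' hpq
  · subst h'
    exact P.refl' p
  · exact P.symm' (main q p h' (P'.symm' hpq))

/-- `K` is a bijection of `NC(n)`. -/
theorem krewerasMap_bijective (n : ℕ) : Function.Bijective (krewerasMap n) := by
  have : Finite (Setoid (Fin n)) :=
    Finite.of_injective (fun r : Setoid (Fin n) => (r : Fin n → Fin n → Prop))
      (fun r s h => Setoid.ext fun a b => iff_of_eq (congrFun (congrFun h a) b))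
  refine Function.Injective.bijective_of_finite ?_
  rintro ⟨P, hP⟩ ⟨P', hP'⟩ h
  have h : kreweras P = kreweras P' := congrArg Subtype.val h
  rw [kreweras_eq_aux hP, kreweras_eq_aux hP'] at h
  exact Subtype.ext (le_antisymm (le_of_krewerasAux_le hP' h.ge) (le_of_krewerasAux_le hP h.le))

/-- The Kreweras complement `K` on `NC(n)`, as a bijection; its inverse is `K⁻¹`. -/
noncomputable def K (n : ℕ) : NC n ≃ NC n := Equiv.ofBijective _ (krewerasMap_bijective n)

/-- The relative Kreweras complement `K^N(P)` for `P ≤ N`: inside each block `B` of `N` take the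
Kreweras complement of the restriction `P | B`, and take the union of the results. -/
def relKreweras {α : Type*} [LinearOrder α] (N P : Setoid α) : Setoid α where
  r x y := ∃ B ∈ N.classes, ∃ (hx : x ∈ B) (hy : y ∈ B),
    kreweras (P.comap (Subtype.val : B → α)) ⟨x, hx⟩ ⟨y, hy⟩
  iseqv :=
    { refl := fun x => ⟨_, N.mem_classes x, N.refl' x, N.refl' x, Setoid.refl' _ _⟩
      symm := by
        rintro x y ⟨B, hB, hx, hy, h⟩
        exact ⟨B, hB, hy, hx, Setoid.symm' _ h⟩
      trans := by
        rintro x y z ⟨B, hB, hx, hy, h⟩ ⟨C, hC, hy', hz, h'⟩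
        obtain rfl := Setoid.eq_of_mem_classes hB hy hC hy'
        exact ⟨B, hB, hx, hz, Setoid.trans' _ h h'⟩ }

/-- The classical delta sequence
`∂(P_1, …, P_k) = (K^{P_2}(P_1), …, K^{P_k}(P_{k-1}), K(P_k))` of a multichain in `NC(n)`. -/
def classicalDelta {n k : ℕ} (P : Fin k → Setoid (Fin n)) (i : Fin k) : Setoid (Fin n) :=
  if h : i.val + 1 < k then relKreweras (P ⟨i.val + 1, h⟩) (P i) else kreweras (P i)

/-! ## Edelman's poset -/

/-- Every block has cardinality divisible by `k`. -/
def IsKDivisible (k : ℕ) {α : Type*} (P : Setoid α) : Prop := ∀ B ∈ P.classes, k ∣ B.ncard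

/-- Edelman's poset `NC^{(k)}(n)`: the induced subposet of `NC(kn)` of `k`-divisible partitions. -/
abbrev EdelmanNC (k n : ℕ) : Type := {P : NC (n * k) // IsKDivisible k P.1}

/-! ## The algebraic `k`-divisible noncrossing partitions of the symmetric group -/

/-- The absolute length `ℓ_T(w)`: the word length of `w` with respect to all transpositions. -/
noncomputable def absLength {n : ℕ} (w : Equiv.Perm (Fin n)) : ℕ :=
  sInf {r | ∃ l : List (Equiv.Perm (Fin n)), l.length = r ∧ (∀ t ∈ l, t.IsSwap) ∧ l.prod = w}

/-- The absolute order `π ≤_T μ`. -/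
def AbsLE {n : ℕ} (π μ : Equiv.Perm (Fin n)) : Prop :=
  absLength μ = absLength π + absLength (π⁻¹ * μ)

/-- The noncrossing partitions `NC(A_{n-1}) = [1, c]` in the absolute order on the symmetric group,
for the Coxeter element `c = (1 2 ⋯ n)`, which is `finRotate n`. -/
def NCSym (n : ℕ) : Set (Equiv.Perm (Fin n)) := {w | AbsLE 1 w ∧ AbsLE w (finRotate n)}

/-- `k`-multichains `π_1 ≤_T ⋯ ≤_T π_k` in `NC(A_{n-1})`, the elements of `NC^{(k)}(A_{n-1})`. -/
@[ext]
structure KDivSym (k n : ℕ) where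
  /-- The entries of the multichain. -/
  perm : Fin k → Equiv.Perm (Fin n)
  mem : ∀ i, perm i ∈ NCSym n
  chain : ∀ i j, i ≤ j → AbsLE (perm i) (perm j)

/-- The entries `(δ_1, …, δ_k) = (π_1⁻¹ π_2, …, π_{k-1}⁻¹ π_k, π_k⁻¹ c)` of the delta sequence
`∂(π)_k`. -/
def KDivSym.delta {k n : ℕ} (π : KDivSym k n) (i : Fin k) : Equiv.Perm (Fin n) :=
  if h : i.val + 1 < k then (π.perm i)⁻¹ * π.perm ⟨i.val + 1, h⟩
  else (π.perm i)⁻¹ * finRotate n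

/-- The partial order of `NC^{(k)}(A_{n-1})`: the reverse of the componentwise absolute order on
delta sequences. -/
instance {k n : ℕ} : LE (KDivSym k n) := ⟨fun π μ => ∀ i, AbsLE (μ.delta i) (π.delta i)⟩

/-- The partition `{π}` of `[n]` into the orbits of the permutation `π`. -/
def orbits {n : ℕ} (π : Equiv.Perm (Fin n)) : Setoid (Fin n) := Equiv.Perm.SameCycle.setoid π

/-- The sequence `({π_1}, …, {π_k})` of a multichain of permutations. -/
def KDivSym.orbitSeq {k n : ℕ} (π : KDivSym k n) (i : Fin k) : Setoid (Fin n) := orbits (π.perm i)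

end KDivNC

open KDivNC

namespace KDivNC

open Equiv

/-! ## Set partitions and numbers of blocks -/

theorem card_quotient_le_of_le {α : Type*} [Finite α] {R S : Setoid α} (h : R ≤ S) :
    Nat.card (Quotient S) ≤ Nat.card (Quotient R) :=
  Nat.card_le_card_of_surjective (Quotient.map' id h : Quotient R → Quotient S)
    (fun q => by induction q using Quotient.inductionOn' with | _ x => exact ⟨Quotient.mk'' x, rfl⟩)

theorem eq_of_le_of_card_quotient_le {α : Type*} [Finite α] {R S : Setoid α} (h : R ≤ S)
    (hc : Nat.card (Quotient R) ≤ Nat.card (Quotient S)) : R = S := by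
  have hs : Function.Surjective (Quotient.map' id h : Quotient R → Quotient S) := fun q => by
    induction q using Quotient.inductionOn' with | _ x => exact ⟨Quotient.mk'' x, rfl⟩
  have hb := (Nat.bijective_iff_surjective_and_card _).2
    ⟨hs, le_antisymm hc (card_quotient_le_of_le h)⟩
  refine le_antisymm h fun x y hxy => ?_
  exact Quotient.eq''.1 (hb.1 (a₁ := Quotient.mk'' x) (a₂ := Quotient.mk'' y)
    (Quotient.eq''.2 hxy))

theorem card_quotient_comap {α β : Type*} {g : α → β} (hg : Function.Surjective g)
    (R : Setoid β) : Nat.card (Quotient (R.comap g)) = Nat.card (Quotient R) := by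
  rw [Nat.card_congr (Setoid.comapQuotientEquiv g R),
    (Quotient.mk''_surjective.comp hg).range_eq, Nat.card_congr (Equiv.Set.univ _)]

theorem orbits_apply_right {n : ℕ} (w : Perm (Fin n)) (x : Fin n) : orbits w x (w x) :=
  ⟨1, by simp⟩

theorem rel_pow {α : Type*} {R : Setoid α} {w : Perm α} (h : ∀ x, R x (w x)) (m : ℕ) (x : α) :
    R x ((w ^ m) x) := by
  induction m with
  | zero => exact R.refl' x
  | succ m ih => rw [pow_succ']; exact R.trans' ih (h _)

theorem orbits_le_iff {n : ℕ} {w : Perm (Fin n)} {R : Setoid (Fin n)} :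
    orbits w ≤ R ↔ ∀ x, R x (w x) := by
  refine ⟨fun h x => h (orbits_apply_right w x), fun h x y hxy => ?_⟩
  obtain ⟨m, rfl⟩ := Perm.SameCycle.exists_nat_pow_eq hxy
  exact rel_pow h m x

theorem orbits_conj {n : ℕ} (u w : Perm (Fin n)) :
    orbits (u * w * u⁻¹) = (orbits w).comap ⇑u⁻¹ :=
  Setoid.ext fun _ _ => Perm.sameCycle_conj

/-! ## The absolute length -/

/-- The partition generated by a list of `r` transpositions has at least `n - r` blocks. -/
theorem exists_setoid_of_swaps {n : ℕ} (l : List (Perm (Fin n))) (hl : ∀ t ∈ l, t.IsSwap) :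
    ∃ R : Setoid (Fin n), (∀ t ∈ l, ∀ x, R x (t x)) ∧ n ≤ Nat.card (Quotient R) + l.length := by
  classical
  induction l with
  | nil => exact ⟨⊥, by simp, by rw [Nat.card_congr Setoid.quotientBotEquiv]; simp⟩
  | cons t l ih =>
    obtain ⟨R, hR, hc⟩ := ih fun t ht => hl t (List.mem_cons_of_mem _ ht)
    obtain ⟨a, b, -, rfl⟩ := hl t List.mem_cons_self
    let f : Quotient R → Quotient R := Function.update id (Quotient.mk'' b) (Quotient.mk'' a)
    let g : Fin n → Quotient R := fun x => f (Quotient.mk'' x)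
    have hf : ∀ x, x ≠ Quotient.mk'' b → f x = x := fun x hx => Function.update_of_ne hx _ _
    have hb : g b = Quotient.mk'' a := Function.update_self _ _ _
    have ha : g a = Quotient.mk'' a := by
      by_cases h : (Quotient.mk'' a : Quotient R) = Quotient.mk'' b
      · simp only [g, h]; exact hb.trans h
      · exact hf _ h
    refine ⟨Setoid.ker g, ?_, ?_⟩
    · intro t ht x
      rcases List.mem_cons.1 ht with rfl | ht
      · change g x = g _
        by_cases hxa : x = a
        · subst hxa; rw [swap_apply_left, ha, hb]
        by_cases hxb : x = b
        · subst hxb; rw [swap_apply_right, ha, hb]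
        rw [swap_apply_of_ne_of_ne hxa hxb]
      · exact congrArg f (Quotient.eq''.2 (hR t ht x))
    · rw [Nat.card_congr (Setoid.quotientKerEquivRange g), Nat.card_coe_set_eq]
      have : Set.univ ⊆ insert (Quotient.mk'' b) (Set.range g) := by
        intro q _
        by_cases hq : q = Quotient.mk'' b
        · exact Or.inl hq
        · induction q using Quotient.inductionOn' with | _ x => exact Or.inr ⟨x, hf _ hq⟩
      have h1 := (Set.ncard_le_ncard this (Set.toFinite _)).trans (Set.ncard_insert_le _ _)
      rw [Set.ncard_univ] at h1
      simp only [List.length_cons]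
      omega

theorem rel_list_prod {α : Type*} {R : Setoid α} {l : List (Perm α)}
    (h : ∀ t ∈ l, ∀ x, R x (t x)) (x : α) : R x (l.prod x) := by
  induction l generalizing x with
  | nil => exact R.refl' x
  | cons t l ih =>
    rw [List.prod_cons, Perm.mul_apply]
    exact R.trans' (ih (fun t ht => h t (List.mem_cons_of_mem _ ht)) x)
      (h t List.mem_cons_self _)

theorem exists_swaps {n : ℕ} (w : Perm (Fin n)) : ∃ l : List (Perm (Fin n)),
    l.length + Nat.card (Quotient (orbits w)) ≤ n ∧ (∀ t ∈ l, t.IsSwap) ∧ l.prod = w := by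
  have hcn : ∀ R : Setoid (Fin n), Nat.card (Quotient R) ≤ n := fun R => by
    simpa using Nat.card_le_card_of_surjective _ (Quotient.mk''_surjective (s₁ := R))
  induction hm : n - Nat.card (Quotient (orbits w)) using Nat.strong_induction_on
    generalizing w with
  | _ m ih =>
  by_cases hw : w = 1
  · exact ⟨[], by simpa using hcn _, by simp, by simp [hw]⟩
  obtain ⟨x, hx⟩ : ∃ x, w x ≠ x := by
    by_contra! h
    exact hw (Equiv.ext h)
  have hle : orbits (swap x (w x) * w) ≤ orbits w := by
    rw [orbits_le_iff]
    intro z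
    have hz := orbits_apply_right w z
    have hx := orbits_apply_right w x
    rw [Perm.mul_apply, swap_apply_def]
    split_ifs with h1 h2
    · rw [h1] at hz; exact (orbits w).trans' hz hx
    · rw [h2] at hz; exact (orbits w).trans' hz ((orbits w).symm' hx)
    · exact hz
  have hfix : (swap x (w x) * w) x = x := by simp
  have hlt : Nat.card (Quotient (orbits w)) < Nat.card (Quotient (orbits (swap x (w x) * w))) := by
    by_contra h
    have heq := eq_of_le_of_card_quotient_le hle (not_lt.1 h)
    have h1 : orbits (swap x (w x) * w) x (w x) := by rw [heq]; exact orbits_apply_right w x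
    exact hx (Perm.SameCycle.eq_of_left h1 hfix).symm
  have hc := hcn (orbits (swap x (w x) * w))
  obtain ⟨l, h1, h2, h3⟩ := ih _ (by omega) (swap x (w x) * w) rfl
  refine ⟨swap x (w x) :: l, by simp only [List.length_cons]; omega, ?_, ?_⟩
  · intro t ht
    rcases List.mem_cons.1 ht with rfl | ht
    · exact ⟨x, w x, hx.symm, rfl⟩
    · exact h2 t ht
  · rw [List.prod_cons, h3, swap_mul_self_mul]

theorem exists_reduced_word {n : ℕ} (w : Perm (Fin n)) : ∃ l : List (Perm (Fin n)),
    l.length = absLength w ∧ (∀ t ∈ l, t.IsSwap) ∧ l.prod = w := by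
  obtain ⟨l, -, h2, h3⟩ := exists_swaps w
  exact Nat.sInf_mem
    (s := {r | ∃ l : List (Perm (Fin n)), l.length = r ∧ (∀ t ∈ l, t.IsSwap) ∧ l.prod = w})
    ⟨_, l, rfl, h2, h3⟩

theorem absLength_le_length {n : ℕ} {w : Perm (Fin n)} {l : List (Perm (Fin n))}
    (h : ∀ t ∈ l, t.IsSwap) (hw : l.prod = w) : absLength w ≤ l.length :=
  Nat.sInf_le ⟨l, rfl, h, hw⟩

theorem absLength_add_card_orbits {n : ℕ} (w : Perm (Fin n)) :
    absLength w + Nat.card (Quotient (orbits w)) = n := by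
  refine le_antisymm ?_ ?_
  · obtain ⟨l, h1, h2, h3⟩ := exists_swaps w
    have := absLength_le_length h2 h3
    omega
  · obtain ⟨l, h1, h2, h3⟩ := exists_reduced_word w
    obtain ⟨R, hR, hc⟩ := exists_setoid_of_swaps l h2
    have hle : orbits w ≤ R := orbits_le_iff.2 fun x => h3 ▸ rel_list_prod hR x
    have := card_quotient_le_of_le hle
    omega

theorem absLength_mul_le {n : ℕ} (u w : Perm (Fin n)) :
    absLength (u * w) ≤ absLength u + absLength w := by
  obtain ⟨l, h1, h2, h3⟩ := exists_reduced_word u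
  obtain ⟨m, h4, h5, h6⟩ := exists_reduced_word w
  rw [← h1, ← h4, ← List.length_append]
  refine absLength_le_length (fun t ht => ?_) (by rw [List.prod_append, h3, h6])
  exact (List.mem_append.1 ht).elim (h2 t) (h5 t)

theorem absLength_conj {n : ℕ} (u w : Perm (Fin n)) :
    absLength (u * w * u⁻¹) = absLength w := by
  have h1 := absLength_add_card_orbits (u * w * u⁻¹)
  have h2 := absLength_add_card_orbits w
  rw [orbits_conj, card_quotient_comap (u⁻¹).surjective] at h1
  omega

theorem absLength_mul_comm {n : ℕ} (u w : Perm (Fin n)) :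
    absLength (u * w) = absLength (w * u) := by
  rw [← absLength_conj w (u * w)]
  congr 1
  group

theorem absLength_one {n : ℕ} : absLength (1 : Perm (Fin n)) = 0 :=
  Nat.le_zero.1 (absLength_le_length (l := []) (by simp) (by simp))

theorem one_absLE {n : ℕ} (w : Perm (Fin n)) : AbsLE 1 w := by
  simp [AbsLE, absLength_one]

theorem AbsLE.refl {n : ℕ} (w : Perm (Fin n)) : AbsLE w w := by
  simp [AbsLE, absLength_one]

theorem AbsLE.trans {n : ℕ} {u v w : Perm (Fin n)} (h : AbsLE u v) (h' : AbsLE v w) :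
    AbsLE u w := by
  unfold AbsLE at *
  have h1 := absLength_mul_le (u⁻¹ * v) (v⁻¹ * w)
  have h2 := absLength_mul_le u (u⁻¹ * w)
  rw [mul_inv_cancel_left] at h2
  rw [mul_assoc, mul_inv_cancel_left] at h1
  omega

theorem AbsLE.inv_mul {n : ℕ} {u w : Perm (Fin n)} (h : AbsLE u w) : AbsLE (u⁻¹ * w) w := by
  unfold AbsLE at *
  have : (u⁻¹ * w)⁻¹ * w = w⁻¹ * u * w⁻¹⁻¹ := by group
  rw [this, absLength_conj, h, add_comm]

theorem AbsLE.orbits_le {n : ℕ} {u w : Perm (Fin n)} (h : AbsLE u w) : orbits u ≤ orbits w := by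
  obtain ⟨l, h1, h2, h3⟩ := exists_reduced_word u
  obtain ⟨m, h4, h5, h6⟩ := exists_reduced_word (u⁻¹ * w)
  obtain ⟨R, hR, hc⟩ := exists_setoid_of_swaps (l ++ m)
    fun t ht => (List.mem_append.1 ht).elim (h2 t) (h5 t)
  have hu : orbits u ≤ R := orbits_le_iff.2 fun x => h3 ▸
    rel_list_prod (fun t ht => hR t (List.mem_append_left _ ht)) x
  have hprod : (l ++ m).prod = w := by rw [List.prod_append, h3, h6, mul_inv_cancel_left]
  have hw : orbits w ≤ R := orbits_le_iff.2 fun x => hprod ▸ rel_list_prod hR x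
  rw [List.length_append, h1, h4, ← show _ = _ from h] at hc
  have := absLength_add_card_orbits w
  rwa [eq_of_le_of_card_quotient_le hw (by omega)]

/-! ## Permutations whose cycles are increasing -/

/-- `w` sends every `x` to the cyclic successor of `x` in its block of `P`. -/
structure IsCyclicSucc {n : ℕ} (P : Setoid (Fin n)) (w : Perm (Fin n)) : Prop where
  rel : ∀ x, P x (w x)
  next : ∀ x y, P x y → x < y → x < w x ∧ w x ≤ y

/-- The number of excedances of a permutation. -/
def exc {n : ℕ} (w : Perm (Fin n)) : ℕ := (Finset.univ.filter fun x => x < w x).card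

theorem exists_min_rel {n : ℕ} (P : Setoid (Fin n)) (x : Fin n) :
    ∃ m, P x m ∧ ∀ y, P x y → m ≤ y := by
  classical
  obtain ⟨m, hm, hmin⟩ := (Finset.univ.filter fun z => P x z).exists_min_image id
    ⟨x, by simp⟩
  exact ⟨m, by simpa using hm, fun y hy => hmin y (by simpa using hy)⟩

theorem exists_max_rel {n : ℕ} (P : Setoid (Fin n)) (x : Fin n) :
    ∃ m, P x m ∧ ∀ y, P x y → y ≤ m := by
  classical
  obtain ⟨m, hm, hmin⟩ := (Finset.univ.filter fun z => P x z).exists_max_image id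
    ⟨x, by simp⟩
  exact ⟨m, by simpa using hm, fun y hy => hmin y (by simpa using hy)⟩

theorem IsCyclicSucc.wrap {n : ℕ} {P : Setoid (Fin n)} {w : Perm (Fin n)} (h : IsCyclicSucc P w)
    {x y : Fin n} (hx : w x ≤ x) (hxy : P x y) : w x ≤ y ∧ y ≤ x := by
  have hmax : ∀ y, P x y → y ≤ x := fun y hy => not_lt.1 fun hlt =>
    absurd (h.next x y hy hlt).1 (not_lt.2 hx)
  refine ⟨?_, hmax y hxy⟩
  obtain ⟨m, hm, hmin⟩ := exists_min_rel P x
  obtain ⟨z, rfl⟩ := w.surjective m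
  have hxz : P x z := P.trans' hm (P.symm' (h.rel z))
  rcases (hmax z hxz).lt_or_eq with hlt | rfl
  · exact absurd (h.next z x (P.symm' hxz) hlt).1 (not_lt.2 (hmin z hxz))
  · exact hmin y hxy

theorem IsCyclicSucc.orbits_eq {n : ℕ} {P : Setoid (Fin n)} {w : Perm (Fin n)}
    (h : IsCyclicSucc P w) : orbits w = P := by
  refine le_antisymm (orbits_le_iff.2 h.rel) ?_
  have key : ∀ d : ℕ, ∀ x y : Fin n, P x y → x < y → y.val - x.val = d → orbits w x y := by
    intro d
    induction d using Nat.strong_induction_on with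
    | _ d ih =>
    intro x y hxy hlt hd
    obtain ⟨h1, h2⟩ := h.next x y hxy hlt
    refine (orbits w).trans' (orbits_apply_right w x) ?_
    rcases h2.lt_or_eq with h3 | h3
    · exact ih _ (by simp only [Fin.lt_def] at *; omega) (w x) y
        (P.trans' (P.symm' (h.rel x)) hxy) h3 rfl
    · rw [h3]
  intro x y hxy
  rcases lt_trichotomy x y with h' | rfl | h'
  · exact key _ x y hxy h' rfl
  · exact (orbits w).refl' x
  · exact (orbits w).symm' (key _ y x (P.symm' hxy) h' rfl)

theorem IsCyclicSucc.unique {n : ℕ} {P : Setoid (Fin n)} {w w' : Perm (Fin n)}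
    (h : IsCyclicSucc P w) (h' : IsCyclicSucc P w') : w = w' := by
  ext x : 1
  rcases lt_or_ge x (w x) with hx | hx
  · obtain ⟨h1, h2⟩ := h'.next x _ (h.rel x) hx
    exact le_antisymm (h.next x _ (h'.rel x) h1).2 h2
  · have hx' : w' x ≤ x := not_lt.1 fun hlt =>
      absurd (h.next x _ (h'.rel x) hlt).1 (not_lt.2 hx)
    exact le_antisymm (h.wrap hx (h'.rel x)).1 (h'.wrap hx' (h.rel x)).1

theorem exists_isCyclicSucc {n : ℕ} (P : Setoid (Fin n)) : ∃ w, IsCyclicSucc P w := by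
  classical
  have hex : ∀ x, ∃ y, P x y ∧ ((x < y ∧ ∀ z, P x z → x < z → y ≤ z) ∨
      (∀ z, P x z → z ≤ x ∧ y ≤ z)) := by
    intro x
    by_cases hx : ∃ z, P x z ∧ x < z
    · obtain ⟨m, hm, hmin⟩ := (Finset.univ.filter fun z => P x z ∧ x < z).exists_min_image id
        (by obtain ⟨z, hz⟩ := hx; exact ⟨z, by simpa using hz⟩)
      simp only [Finset.mem_filter, Finset.mem_univ, true_and, id] at hm hmin
      exact ⟨m, hm.1, Or.inl ⟨hm.2, fun z h1 h2 => hmin z ⟨h1, h2⟩⟩⟩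
    · obtain ⟨m, hm, hmin⟩ := exists_min_rel P x
      exact ⟨m, hm, Or.inr fun z hz => ⟨not_lt.1 fun hlt => hx ⟨z, hz, hlt⟩, hmin z hz⟩⟩
  choose f hf hf' using hex
  have hlt : ∀ x y, f x = f y → ¬ x < y := by
    intro x y hxy hlt
    have hP : P x y := P.trans' (hf x) (hxy ▸ P.symm' (hf y))
    have hPs := P.symm' hP
    rcases hf' x with ⟨h1, h2⟩ | h1
    · have h3 := h2 y hP hlt
      rcases hf' y with ⟨h4, -⟩ | h4
      · exact absurd h3 (not_le.2 (hxy ▸ h4))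
      · exact absurd ((h4 x hPs).2) (not_le.2 (hxy ▸ h1))
    · exact absurd (h1 y hP).1 (not_le.2 hlt)
  have hinj : Function.Injective f := fun x y hxy => by
    rcases lt_trichotomy x y with h | h | h
    · exact absurd h (hlt x y hxy)
    · exact h
    · exact absurd h (hlt y x hxy.symm)
  refine ⟨Equiv.ofBijective f hinj.bijective_of_finite, hf, fun x y hxy h => ?_⟩
  change x < f x ∧ f x ≤ y
  rcases hf' x with ⟨h1, h2⟩ | h1
  · exact ⟨h1, h2 y hxy h⟩
  · exact absurd (h1 y hxy).1 (not_le.2 h)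

/-- The class of a non-excedance. -/
def nonexcClass {n : ℕ} (P : Setoid (Fin n)) (w : Perm (Fin n)) (x : {x // ¬ x < w x}) :
    Quotient P := Quotient.mk'' x.1

theorem nonexcClass_surjective {n : ℕ} {P : Setoid (Fin n)} {w : Perm (Fin n)}
    (h : ∀ x, P x (w x)) : Function.Surjective (nonexcClass P w) := fun q => by
  induction q using Quotient.inductionOn' with | _ x =>
  obtain ⟨m, hm, hmax⟩ := exists_max_rel P x
  exact ⟨⟨m, not_lt.2 (hmax _ (P.trans' hm (h m)))⟩, Quotient.eq''.2 (P.symm' hm)⟩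

theorem card_nonexc {n : ℕ} (w : Perm (Fin n)) : Nat.card {x // ¬ x < w x} + exc w = n := by
  have := Finset.card_filter_add_card_filter_not (s := (Finset.univ : Finset (Fin n)))
    (fun x => x < w x)
  rw [Nat.card_eq_fintype_card, Fintype.card_subtype, add_comm, exc, this, Finset.card_univ,
    Fintype.card_fin]

theorem exc_le_absLength {n : ℕ} (w : Perm (Fin n)) : exc w ≤ absLength w := by
  have h1 := card_nonexc w
  have h2 := absLength_add_card_orbits w
  have h3 := Nat.card_le_card_of_surjective _ (nonexcClass_surjective (orbits_apply_right w))
  omega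

theorem isCyclicSucc_of_absLength_le {n : ℕ} {w : Perm (Fin n)} (h : absLength w ≤ exc w) :
    IsCyclicSucc (orbits w) w := by
  have h1 := card_nonexc w
  have h2 := absLength_add_card_orbits w
  have hs := nonexcClass_surjective (orbits_apply_right w)
  have h3 := Nat.card_le_card_of_surjective _ hs
  have hb := (Nat.bijective_iff_surjective_and_card _).2 ⟨hs, by omega⟩
  have hmax : ∀ x y, orbits w x y → w x ≤ x → y ≤ x := by
    intro x y hxy hx
    obtain ⟨m, hm, hmax⟩ := exists_max_rel (orbits w) x
    have := hb.1 (a₁ := ⟨x, not_lt.2 hx⟩)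
      (a₂ := ⟨m, not_lt.2 (hmax _ ((orbits w).trans' hm (orbits_apply_right w m)))⟩)
      (Quotient.eq''.2 hm)
    obtain rfl : x = m := congrArg Subtype.val this
    exact hmax y hxy
  have hexc : ∀ x y, orbits w x y → x < y → x < w x := fun x y hxy hlt =>
    not_le.1 fun h => absurd (hmax x y hxy h) (not_le.2 hlt)
  refine ⟨orbits_apply_right w, fun x y hxy hlt => ⟨hexc x y hxy hlt, ?_⟩⟩
  induction hd : y.val using Nat.strong_induction_on generalizing x y with
  | _ d ih =>
  by_contra! hc
  obtain ⟨z, rfl⟩ := w.surjective y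
  have hz := orbits_apply_right w z
  have hxz := (orbits w).trans' hxy ((orbits w).symm' hz)
  rcases lt_or_ge z (w z) with hzy | hzy
  · rcases lt_trichotomy x z with h4 | rfl | h4
    · exact absurd (ih _ (by simpa [← hd] using hzy) x z hxz h4 rfl)
        (not_le.2 (hzy.trans hc))
    · exact lt_irrefl _ hc
    · exact absurd (ih _ (by simpa [← hd] using hlt) z x ((orbits w).symm' hxz) h4 rfl)
        (not_le.2 hlt)
  · obtain ⟨m, hm, hmin⟩ := exists_min_rel (orbits w) x
    obtain ⟨m', rfl⟩ := w.surjective m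
    have hxm' := (orbits w).trans' hm ((orbits w).symm' (orbits_apply_right w m'))
    have hzm' := (orbits w).trans' ((orbits w).symm' hxz) hxm'
    have h5 := hmax z m' hzm' hzy
    have h6 := hmax m' z ((orbits w).symm' hzm') (hmin _ hxm')
    obtain rfl := le_antisymm h5 h6
    exact absurd (hmin x ((orbits w).refl' x)) (not_le.2 hlt)

theorem IsCyclicSucc.absLength_eq {n : ℕ} {P : Setoid (Fin n)} {w : Perm (Fin n)}
    (h : IsCyclicSucc P w) : absLength w = exc w := by
  have hi : Function.Injective (nonexcClass P w) := by
    rintro ⟨x, hx⟩ ⟨y, hy⟩ hxy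
    have hP : P x y := Quotient.eq''.1 hxy
    exact Subtype.ext (le_antisymm (h.wrap (not_lt.1 hy) (P.symm' hP)).2
      (h.wrap (not_lt.1 hx) hP).2)
  have h1 := card_nonexc w
  have h2 := absLength_add_card_orbits w
  have h3 := Nat.card_le_card_of_injective _ hi
  have h4 := exc_le_absLength w
  rw [h.orbits_eq] at h2
  omega

/-- Excedances are additive along `π⁻¹ μ`. -/
theorem IsCyclicSucc.exc_add {n : ℕ} {N : Setoid (Fin n)} {u w : Perm (Fin n)}
    (hw : IsCyclicSucc N w) (hu : ∀ x, N x (u x)) : exc u + exc (u⁻¹ * w) = exc w := by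
  have h1 : exc u = (Finset.univ.filter fun x => (u⁻¹ * w) x < w x).card := by
    refine (Finset.card_equiv (u⁻¹ * w) fun x => ?_).symm
    rw [Finset.mem_filter, Finset.mem_filter, ← Perm.mul_apply u, mul_inv_cancel_left]
    simp only [Finset.mem_univ, true_and]
  have hN : ∀ x, N x ((u⁻¹ * w) x) := fun x => by
    have := hu ((u⁻¹ * w) x)
    rw [← Perm.mul_apply u, mul_inv_cancel_left] at this
    exact N.trans' (hw.rel x) (N.symm' this)
  rw [h1, exc, exc, ← Finset.card_union_of_disjoint]
  · congr 1
    ext x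
    simp only [Finset.mem_union, Finset.mem_filter, Finset.mem_univ, true_and]
    rcases lt_or_ge x (w x) with hx | hx
    · refine iff_of_true ?_ hx
      rcases lt_or_ge x ((u⁻¹ * w) x) with h | h
      · exact Or.inr h
      · exact Or.inl (h.trans_lt hx)
    · obtain ⟨h2, h3⟩ := hw.wrap hx (hN x)
      exact iff_of_false (by simp only [not_or, not_lt]; exact ⟨h2, h3⟩) (not_lt.2 hx)
  · rw [Finset.disjoint_filter]
    intro x _ h2 h3
    exact absurd (hw.next x _ (hN x) h3).2 (not_le.2 h2)

theorem val_finRotate {n : ℕ} (x : Fin n) :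
    (finRotate n x).val = if x.val + 1 = n then 0 else x.val + 1 := by
  cases n with
  | zero => exact x.elim0
  | succ n =>
    rw [coe_finRotate]
    simp [Fin.ext_iff]

theorem isCyclicSucc_finRotate (n : ℕ) : IsCyclicSucc ⊤ (finRotate n) := by
  refine ⟨fun _ => trivial, fun x y _ h => ?_⟩
  have hx := val_finRotate x
  have hy := y.isLt
  simp only [Fin.lt_def, Fin.le_def] at *
  split_ifs at hx <;> omega

theorem exc_add_exc_finRotate {n : ℕ} (w : Perm (Fin n)) :
    exc w + exc (w⁻¹ * finRotate n) = absLength (finRotate n) := by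
  rw [(isCyclicSucc_finRotate n).absLength_eq]
  exact (isCyclicSucc_finRotate n).exc_add fun _ => trivial

theorem isCyclicSucc_of_absLE_finRotate {n : ℕ} {w : Perm (Fin n)} (h : AbsLE w (finRotate n)) :
    IsCyclicSucc (orbits w) w := by
  have h1 := exc_add_exc_finRotate w
  have h2 := exc_le_absLength (w⁻¹ * finRotate n)
  unfold AbsLE at h
  exact isCyclicSucc_of_absLength_le (by omega)

theorem IsCyclicSucc.exists_straddle {n : ℕ} {P : Setoid (Fin n)} {w : Perm (Fin n)}
    (h : IsCyclicSucc P w) {a t c : Fin n} (hac : P a c) (hat : a < t) (htc : t ≤ c) :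
    ∃ y, P a y ∧ a ≤ y ∧ y < t ∧ t ≤ w y ∧ w y ≤ c := by
  classical
  obtain ⟨y, hy, hmax⟩ := (Finset.univ.filter fun z => P a z ∧ z < t).exists_max_image id
    ⟨a, by simpa using hat⟩
  simp only [Finset.mem_filter, Finset.mem_univ, true_and, id] at hy hmax
  obtain ⟨h1, h2⟩ := h.next y c (P.trans' (P.symm' hy.1) hac) (hy.2.trans_le htc)
  exact ⟨y, hy.1, hmax a ⟨P.refl' a, hat⟩, hy.2,
    not_lt.1 fun hlt => absurd (hmax _ ⟨P.trans' hy.1 (h.rel y), hlt⟩) (not_le.2 h1), h2⟩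

theorem exists_finRotate_eq {n : ℕ} {y s : Fin n} (h : y < s) :
    ∃ x, finRotate n x = s ∧ x.val + 1 = s.val := by
  obtain ⟨x, rfl⟩ := (finRotate n).surjective s
  refine ⟨x, rfl, ?_⟩
  have h1 := val_finRotate x
  rw [Fin.lt_def] at h
  split_ifs at h1 <;> omega

theorem isNoncrossing_orbits {n : ℕ} {w : Perm (Fin n)} (hw : AbsLE w (finRotate n)) :
    IsNoncrossing (orbits w) := by
  intro a b c d hab hbc hcd hac hbd
  induction hm : c.val - b.val using Nat.strong_induction_on generalizing w a b c d with
  | _ m ih =>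
  by_contra hn
  have hP := isCyclicSucc_of_absLE_finRotate hw
  have hQ := isCyclicSucc_of_absLE_finRotate hw.inv_mul
  obtain ⟨y, h1, -, h2, h3, h4⟩ := hP.exists_straddle hac hab hbc.le
  have hay : orbits w a (w y) := (orbits w).trans' h1 (orbits_apply_right w y)
  have h3 : b < w y := lt_of_le_of_ne h3 fun h => hn (h ▸ hay)
  obtain ⟨b', h5, h6, h7, h8, -⟩ := hP.exists_straddle hbd h3 (h4.trans hcd.le)
  have hbb : orbits w b (w b') := (orbits w).trans' h5 (orbits_apply_right w b')
  have h8 : w y < w b' := lt_of_le_of_ne h8 fun h =>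
    hn ((orbits w).trans' (h ▸ hay) ((orbits w).symm' hbb))
  obtain ⟨x₀, hx₀, hv₀⟩ := exists_finRotate_eq h3
  obtain ⟨x₁, hx₁, hv₁⟩ := exists_finRotate_eq h8
  have hu₀ : (w⁻¹ * finRotate n) x₀ = y := by simp [hx₀]
  have hu₁ : (w⁻¹ * finRotate n) x₁ = b' := by simp [hx₁]
  have hr₀ := hQ.rel x₀
  have hr₁ := hQ.rel x₁
  simp only [Fin.lt_def, Fin.le_def] at *
  have hcross : ¬ orbits (w⁻¹ * finRotate n) y b' := by
    intro hyb
    have h9 := hQ.wrap (x := x₁) (y := y) (by rw [Fin.le_def, hu₁]; omega)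
      (Setoid.trans' _ hr₁ (Setoid.symm' _ (by rwa [hu₁])))
    rw [hu₁, Fin.le_def] at h9
    omega
  rw [hu₀] at hr₀
  rw [hu₁] at hr₁
  have h10 : b'.val ≠ x₀.val := by
    intro h
    rw [Fin.ext h] at hcross
    exact hcross (Setoid.symm' _ hr₀)
  exact hcross (ih _ (by omega) hw.inv_mul y b' x₀ x₁ (by omega) (by omega) (by omega)
    (Setoid.symm' _ hr₀) (Setoid.symm' _ hr₁) rfl)

/-- The elements strictly between two cyclically consecutive elements `y < w y` of a block of a
noncrossing partition form a union of blocks. -/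
theorem IsCyclicSucc.between {n : ℕ} {P : Setoid (Fin n)} {w : Perm (Fin n)}
    (h : IsCyclicSucc P w) (hP : IsNoncrossing P) {y p q : Fin n} (hpq : P p q) (h1 : y < p)
    (h2 : p < w y) : y < q ∧ q < w y := by
  have hyw := h.rel y
  have hyp : ¬ P y p := fun hyp => absurd (h.next y p hyp h1).2 (not_le.2 h2)
  have hyq : ¬ P y q := fun hyq => hyp (P.trans' hyq (P.symm' hpq))
  constructor
  · rcases lt_trichotomy y q with h3 | rfl | h3
    · exact h3
    · exact absurd (P.refl' _) hyq
    · exact absurd (P.symm' (hP q y p (w y) h3 h1 h2 (P.symm' hpq) hyw)) hyq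
  · rcases lt_trichotomy q (w y) with h3 | rfl | h3
    · exact h3
    · exact absurd hyw hyq
    · exact absurd (hP y p (w y) q h1 h2 h3 hyw hpq) hyp

/-- The elements between the minimum and the maximum of a block of a noncrossing partition form a
union of blocks. -/
theorem IsCyclicSucc.between_of_le {n : ℕ} {P : Setoid (Fin n)} {w : Perm (Fin n)}
    (h : IsCyclicSucc P w) (hP : IsNoncrossing P) {y p q : Fin n} (hy : w y ≤ y) (hpq : P p q)
    (h1 : w y ≤ p) (h2 : p ≤ y) : w y ≤ q ∧ q ≤ y := by
  by_cases hyp : P y p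
  · exact h.wrap hy (P.trans' hyp hpq)
  have hyw := h.rel y
  have hyq : ¬ P y q := fun hyq => hyp (P.trans' hyq (P.symm' hpq))
  have h1 : w y < p := lt_of_le_of_ne h1 (by rintro rfl; exact hyp hyw)
  have h2 : p < y := lt_of_le_of_ne h2 (by rintro rfl; exact hyp (P.refl' _))
  constructor
  · by_contra! h3
    exact hyq (P.trans' hyw (P.symm' (hP q (w y) p y h3 h1 h2 (P.symm' hpq) (P.symm' hyw))))
  · by_contra! h3
    exact hyp (P.trans' hyw (hP (w y) p y q h1 h2 h3 (P.symm' hyw) hpq))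

/-- The relative Kreweras complement of `P ≤ N` belongs to the product of the inverse of the
permutation of `P` with the permutation of `N`. -/
theorem IsCyclicSucc.inv_mul {n : ℕ} {P N Q : Setoid (Fin n)} {u w : Perm (Fin n)}
    (hu : IsCyclicSucc P u) (hw : IsCyclicSucc N w) (hPN : P ≤ N) (hP : IsNoncrossing P)
    (hQ : ∀ x y, Q x y ↔ N x y ∧ ∀ p q, N x p → P p q → ((x < p ↔ y < p) ↔ (x < q ↔ y < q))) :
    IsCyclicSucc Q (u⁻¹ * w) := by
  have main : ∀ x y, u y = w x → N x y := fun x y hxy =>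
    N.trans' (hw.rel x) (N.symm' (hxy ▸ hPN (hu.rel y)))
  constructor
  · intro x
    obtain ⟨y, hy⟩ := u.surjective (w x)
    have hN := main x y hy
    have : (u⁻¹ * w) x = y := by simp [← hy]
    rw [this, hQ]
    refine ⟨hN, fun p q hp hpq => ?_⟩
    have hq := N.trans' hp (hPN hpq)
    have hqp := P.symm' hpq
    rcases lt_or_ge x (w x) with hx | hx
    · have hp' : x < p ↔ u y ≤ p :=
        ⟨fun h => hy ▸ (hw.next x p hp h).2, fun h => hx.trans_le (hy ▸ h)⟩
      have hq' : x < q ↔ u y ≤ q :=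
        ⟨fun h => hy ▸ (hw.next x q hq h).2, fun h => hx.trans_le (hy ▸ h)⟩
      rw [hp', hq']
      rcases lt_or_ge y (u y) with hy' | hy'
      · have h1 := hu.between (y := y) hP hpq
        have h2 := hu.between (y := y) hP hqp
        simp only [Fin.lt_def, Fin.le_def] at *
        grind
      · have h1 := hu.between_of_le hP hy' hpq
        have h2 := hu.between_of_le hP hy' hqp
        simp only [Fin.lt_def, Fin.le_def] at *
        grind
    · have h3 := hw.wrap hx hp
      have h4 := hw.wrap hx hq
      have h5 := hw.wrap hx hN
      rw [← hy] at h3 h4 h5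
      have h1 := hu.between_of_le hP h5.1 hpq
      have h2 := hu.between_of_le hP h5.1 hqp
      simp only [Fin.lt_def, Fin.le_def] at *
      grind
  · intro x z hxz hlt
    obtain ⟨y, hy⟩ := u.surjective (w x)
    have : (u⁻¹ * w) x = y := by simp [← hy]
    rw [this]
    obtain ⟨hN, h⟩ := (hQ x z).1 hxz
    have h1 := h (w x) y (hw.rel x) (hy ▸ P.symm' (hu.rel y))
    have h2 := hw.next x z hN hlt
    simp only [Fin.lt_def, Fin.le_def] at *
    grind

theorem relKreweras_apply {α : Type*} [LinearOrder α] {P N : Setoid α} (hP : IsNoncrossing P)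
    (hPN : P ≤ N) (x y : α) : relKreweras N P x y ↔
      N x y ∧ ∀ p q, N x p → P p q → ((x < p ↔ y < p) ↔ (x < q ↔ y < q)) := by
  have hB : ∀ B : Set α, IsNoncrossing (P.comap (Subtype.val : B → α)) :=
    fun B a b c d h1 h2 h3 h4 h5 => hP a b c d h1 h2 h3 h4 h5
  constructor
  · rintro ⟨B, hB', hx, hy, h⟩
    rw [kreweras_eq_aux (hB B), krewerasAux_apply] at h
    have hmem : ∀ p, N x p → p ∈ B := fun p hp => by
      obtain ⟨z, rfl⟩ := hB'
      exact N.trans' (N.symm' hp) hx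
    refine ⟨?_, fun p q hp hpq => h ⟨p, hmem p hp⟩ ⟨q, hmem q (N.trans' hp (hPN hpq))⟩ hpq⟩
    obtain ⟨z, rfl⟩ := hB'
    exact N.trans' hx (N.symm' hy)
  · rintro ⟨hxy, h⟩
    refine ⟨_, N.mem_classes x, N.refl' x, N.symm' hxy, ?_⟩
    rw [kreweras_eq_aux (hB _), krewerasAux_apply]
    rintro ⟨p, hp⟩ ⟨q, hq⟩ hpq
    exact h p q (N.symm' hp) hpq

theorem IsCyclicSucc.relKreweras {n : ℕ} {P N : Setoid (Fin n)} {u w : Perm (Fin n)}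
    (hu : IsCyclicSucc P u) (hw : IsCyclicSucc N w) (hPN : P ≤ N) (hP : IsNoncrossing P) :
    IsCyclicSucc (relKreweras N P) (u⁻¹ * w) :=
  hu.inv_mul hw hPN hP (relKreweras_apply hP hPN)

theorem IsCyclicSucc.kreweras {n : ℕ} {P : Setoid (Fin n)} {u : Perm (Fin n)}
    (hu : IsCyclicSucc P u) (hP : IsNoncrossing P) :
    IsCyclicSucc (kreweras P) (u⁻¹ * finRotate n) := by
  refine hu.inv_mul (isCyclicSucc_finRotate n) le_top hP fun x y => ?_
  rw [kreweras_eq_aux hP, krewerasAux_apply]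
  exact ⟨fun h => ⟨trivial, fun p q _ => h p q⟩, fun h p q => h.2 p q trivial⟩

/-- Refinement of noncrossing partitions is the absolute order. -/
theorem IsCyclicSucc.absLE {n : ℕ} {P N : Setoid (Fin n)} {u w : Perm (Fin n)}
    (hu : IsCyclicSucc P u) (hw : IsCyclicSucc N w) (hPN : P ≤ N) (hP : IsNoncrossing P) :
    AbsLE u w := by
  rw [AbsLE, hu.absLength_eq, hw.absLength_eq, (hu.relKreweras hw hPN hP).absLength_eq]
  exact (hw.exc_add fun x => hPN (hu.rel x)).symm

theorem IsCyclicSucc.absLE_finRotate {n : ℕ} {P : Setoid (Fin n)} {u : Perm (Fin n)}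
    (hu : IsCyclicSucc P u) (hP : IsNoncrossing P) : AbsLE u (finRotate n) :=
  hu.absLE (isCyclicSucc_finRotate n) le_top hP

theorem absLE_iff_orbits_le {n : ℕ} {u w : Perm (Fin n)} (hu : AbsLE u (finRotate n))
    (hw : AbsLE w (finRotate n)) : AbsLE u w ↔ orbits u ≤ orbits w :=
  ⟨AbsLE.orbits_le, fun h => (isCyclicSucc_of_absLE_finRotate hu).absLE
    (isCyclicSucc_of_absLE_finRotate hw) h (isNoncrossing_orbits hu)⟩

theorem eq_of_orbits_eq {n : ℕ} {u w : Perm (Fin n)} (hu : AbsLE u (finRotate n))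
    (hw : AbsLE w (finRotate n)) (h : orbits u = orbits w) : u = w :=
  (isCyclicSucc_of_absLE_finRotate hu).unique (h ▸ isCyclicSucc_of_absLE_finRotate hw)

/-! ## Shuffles of permutations -/

/-- The permutation of `[kn]` that acts as `δ i` on the copy of `[n]` of residue `i`. -/
def shufflePerm {n k : ℕ} (δ : Fin k → Perm (Fin n)) : Perm (Fin (n * k)) :=
  (finProdFinEquiv.symm.trans (Equiv.prodCongrLeft δ)).trans finProdFinEquiv

theorem shufflePerm_apply {n k : ℕ} (δ : Fin k → Perm (Fin n)) (x : Fin n) (i : Fin k) :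
    shufflePerm δ (finProdFinEquiv (x, i)) = finProdFinEquiv (δ i x, i) := by
  simp [shufflePerm]

theorem exists_finProdFinEquiv {n k : ℕ} (z : Fin (n * k)) :
    ∃ x i, z = (finProdFinEquiv (x, i) : Fin (n * k)) := by
  obtain ⟨⟨x, i⟩, rfl⟩ := finProdFinEquiv.surjective z
  exact ⟨x, i, rfl⟩

theorem divNat_finProdFinEquiv {n k : ℕ} (x : Fin n) (i : Fin k) :
    (finProdFinEquiv (x, i)).divNat = x :=
  congrArg Prod.fst (finProdFinEquiv.symm_apply_apply (x, i))

theorem modNat_finProdFinEquiv {n k : ℕ} (x : Fin n) (i : Fin k) :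
    (finProdFinEquiv (x, i)).modNat = i :=
  congrArg Prod.snd (finProdFinEquiv.symm_apply_apply (x, i))

theorem shuffle_apply {n k : ℕ} (Q : Fin k → Setoid (Fin n)) (x y : Fin n) (i j : Fin k) :
    shuffle Q (finProdFinEquiv (x, i)) (finProdFinEquiv (y, j)) ↔ i = j ∧ Q i x y := by
  change (finProdFinEquiv (x, i)).modNat = (finProdFinEquiv (y, j)).modNat ∧
    Q (finProdFinEquiv (x, i)).modNat (finProdFinEquiv (x, i)).divNat
      (finProdFinEquiv (y, j)).divNat ↔ _
  rw [divNat_finProdFinEquiv, divNat_finProdFinEquiv, modNat_finProdFinEquiv,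
    modNat_finProdFinEquiv]

theorem shuffle_le_iff {n k : ℕ} {Q R : Fin k → Setoid (Fin n)} :
    shuffle Q ≤ shuffle R ↔ ∀ i, Q i ≤ R i := by
  constructor
  · intro h i x y hxy
    exact ((shuffle_apply R x y i i).1 (h ((shuffle_apply Q x y i i).2 ⟨rfl, hxy⟩))).2
  · intro h z z' hz
    obtain ⟨x, i, rfl⟩ := exists_finProdFinEquiv z
    obtain ⟨y, j, rfl⟩ := exists_finProdFinEquiv z'
    rw [shuffle_apply] at hz ⊢
    exact ⟨hz.1, h i hz.2⟩

theorem orbits_shufflePerm {n k : ℕ} (δ : Fin k → Perm (Fin n)) :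
    orbits (shufflePerm δ) = shuffle fun i => orbits (δ i) := by
  refine le_antisymm (orbits_le_iff.2 fun z => ?_) fun z z' hz => ?_
  · obtain ⟨x, i, rfl⟩ := exists_finProdFinEquiv z
    rw [shufflePerm_apply, shuffle_apply]
    exact ⟨rfl, orbits_apply_right _ _⟩
  · obtain ⟨x, i, rfl⟩ := exists_finProdFinEquiv z
    obtain ⟨y, j, rfl⟩ := exists_finProdFinEquiv z'
    obtain ⟨rfl, h⟩ := (shuffle_apply _ _ _ _ _).1 hz
    obtain ⟨m, rfl⟩ := Perm.SameCycle.exists_nat_pow_eq h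
    have hpow : (shufflePerm δ ^ m) (finProdFinEquiv (x, i)) =
        finProdFinEquiv ((δ i ^ m) x, i) := by
      clear hz h
      induction m with
      | zero => rfl
      | succ m ih =>
        rw [pow_succ', Perm.mul_apply, ih, shufflePerm_apply, pow_succ', Perm.mul_apply]
    exact hpow ▸ rel_pow (orbits_apply_right _) m _

theorem card_quotient_shuffle {n k : ℕ} (Q : Fin k → Setoid (Fin n)) :
    Nat.card (Quotient (shuffle Q)) = ∑ i, Nat.card (Quotient (Q i)) := by
  let f : Fin (n * k) → Σ i, Quotient (Q i) := fun z => ⟨z.modNat, Quotient.mk'' z.divNat⟩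
  have hfe : ∀ x i, f (finProdFinEquiv (x, i)) = ⟨i, Quotient.mk'' x⟩ := fun x i => by
    simp only [f]
    rw [modNat_finProdFinEquiv, divNat_finProdFinEquiv]
  have hf : Function.Surjective f := by
    rintro ⟨i, q⟩
    induction q using Quotient.inductionOn' with | _ x => exact ⟨_, hfe x i⟩
  have hker : shuffle Q = Setoid.ker f := by
    ext z z'
    obtain ⟨x, i, rfl⟩ := exists_finProdFinEquiv z
    obtain ⟨y, j, rfl⟩ := exists_finProdFinEquiv z'
    rw [shuffle_apply, Setoid.ker_def, hfe, hfe]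
    constructor
    · rintro ⟨rfl, h⟩
      rw [Quotient.eq''.2 h]
    · intro h
      obtain rfl : i = j := congrArg Sigma.fst h
      exact ⟨rfl, Quotient.eq''.1 (eq_of_heq (Sigma.mk.inj h).2)⟩
  rw [hker, Nat.card_congr (Setoid.quotientKerEquivOfSurjective f hf), Nat.card_sigma]

theorem absLength_shufflePerm {n k : ℕ} (δ : Fin k → Perm (Fin n)) :
    absLength (shufflePerm δ) = ∑ i, absLength (δ i) := by
  have h1 := absLength_add_card_orbits (shufflePerm δ)
  rw [orbits_shufflePerm, card_quotient_shuffle] at h1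
  have h2 : ∑ i, (absLength (δ i) + Nat.card (Quotient (orbits (δ i)))) = n * k := by
    simp [absLength_add_card_orbits, mul_comm]
  rw [Finset.sum_add_distrib] at h2
  omega

theorem finRotate_finProdFinEquiv_of_lt {n k : ℕ} (x : Fin n) (i : Fin k) (h : i.val + 1 < k) :
    finRotate (n * k) (finProdFinEquiv (x, i)) = finProdFinEquiv (x, ⟨i.val + 1, h⟩) := by
  have h1 := val_finRotate (finProdFinEquiv (x, i))
  have h2 : k * (x.val + 1) ≤ k * n := Nat.mul_le_mul_left k x.isLt
  rw [Fin.ext_iff, h1, finProdFinEquiv_apply_val, finProdFinEquiv_apply_val, mul_comm n k]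
  simp only [mul_add, mul_one] at *
  rw [if_neg (by omega)]
  omega

theorem finRotate_finProdFinEquiv_of_eq {n k : ℕ} (x : Fin n) (i : Fin k) (h : i.val + 1 = k) :
    finRotate (n * k) (finProdFinEquiv (x, i)) =
      finProdFinEquiv (finRotate n x, ⟨0, i.pos⟩) := by
  have h1 := val_finRotate (finProdFinEquiv (x, i))
  have h3 := val_finRotate x
  have h4 : i.val + k * x.val + 1 = k * (x.val + 1) := by rw [mul_add]; omega
  rw [Fin.ext_iff, h1, finProdFinEquiv_apply_val, finProdFinEquiv_apply_val, mul_comm n k, h3]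
  simp only [h4]
  by_cases hx : x.val + 1 = n
  · simp [hx]
  · have : k * (x.val + 1) ≠ k * n := fun h => hx (Nat.eq_of_mul_eq_mul_left i.pos h)
    simp [hx, this]

/-! ## Delta sequences -/

/-- A sequence of permutations of `[n]`, continued by the Coxeter element. -/
def coxExtend {n k : ℕ} (π : Fin k → Perm (Fin n)) (i : ℕ) : Perm (Fin n) :=
  if h : i < k then π ⟨i, h⟩ else finRotate n

theorem coxExtend_of_lt {n k : ℕ} (π : Fin k → Perm (Fin n)) {i : ℕ} (h : i < k) :
    coxExtend π i = π ⟨i, h⟩ := dif_pos h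

theorem coxExtend_self {n k : ℕ} (π : Fin k → Perm (Fin n)) : coxExtend π k = finRotate n :=
  dif_neg (lt_irrefl k)

/-- The sequence `π_i⁻¹ π_{i+1}`, where `π_{k+1}` is the Coxeter element. -/
def deltaSeq {n k : ℕ} (π : Fin k → Perm (Fin n)) (i : Fin k) : Perm (Fin n) :=
  (π i)⁻¹ * coxExtend π (i.val + 1)

theorem delta_eq_deltaSeq {n k : ℕ} (π : KDivSym k n) : π.delta = deltaSeq π.perm := by
  funext i
  simp only [KDivSym.delta, deltaSeq, coxExtend]
  split_ifs <;> rfl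

theorem exists_deltaSeq_eq {n k : ℕ} (δ : Fin k → Perm (Fin n)) :
    ∃ π : Fin k → Perm (Fin n), deltaSeq π = δ := by
  let a : ℕ → Perm (Fin n) := Nat.rec (finRotate n) fun m w =>
    w * (if h : k - 1 - m < k then δ ⟨k - 1 - m, h⟩ else 1)⁻¹
  have ha : ∀ m, a (m + 1) = a m * (if h : k - 1 - m < k then δ ⟨k - 1 - m, h⟩ else 1)⁻¹ :=
    fun m => rfl
  refine ⟨fun i => a (k - i.val), funext fun i => ?_⟩
  have hi := i.isLt
  have h1 : coxExtend (fun i : Fin k => a (k - i.val)) (i.val + 1) = a (k - (i.val + 1)) := by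
    by_cases h : i.val + 1 < k
    · exact coxExtend_of_lt _ h
    · obtain h : i.val + 1 = k := by omega
      rw [h, coxExtend_self, Nat.sub_self]
      rfl
  have h2 : k - i.val = k - (i.val + 1) + 1 := by omega
  have h3 : k - 1 - (k - (i.val + 1)) = i.val := by omega
  rw [deltaSeq, h1, h2, ha, h3, dif_pos hi]
  group

/-- The orbits of `C ⟨δ_1, …, δ_k⟩⁻¹` are the preimages of the orbits of `π_1`. -/
theorem orbits_finRotate_mul_shufflePerm {n k : ℕ} (hk : 0 < k) (π : Fin k → Perm (Fin n)) :
    orbits (finRotate (n * k) * (shufflePerm (deltaSeq π))⁻¹) =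
      (orbits (π ⟨0, hk⟩)).comap fun z => π z.modNat z.divNat := by
  set t := finRotate (n * k) * (shufflePerm (deltaSeq π))⁻¹ with ht
  have htz : ∀ x i, t (finProdFinEquiv (deltaSeq π i x, i)) =
      finRotate (n * k) (finProdFinEquiv (x, i)) := fun x i => by
    rw [← shufflePerm_apply, ht, ← Perm.mul_apply, inv_mul_cancel_right]
  have hlt : ∀ (i : Fin k) (h : i.val + 1 < k) v,
      t (finProdFinEquiv ((π i)⁻¹ v, i)) = finProdFinEquiv ((π ⟨_, h⟩)⁻¹ v, ⟨_, h⟩) := by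
    intro i h v
    rw [← finRotate_finProdFinEquiv_of_lt, ← htz, deltaSeq, coxExtend_of_lt _ h]
    simp
  have heq : ∀ (i : Fin k), i.val + 1 = k → ∀ v,
      t (finProdFinEquiv ((π i)⁻¹ v, i)) = finProdFinEquiv (v, ⟨0, hk⟩) := by
    intro i h v
    have := finRotate_finProdFinEquiv_of_eq ((finRotate n)⁻¹ v) i h
    rw [← Perm.mul_apply, mul_inv_cancel, Perm.one_apply] at this
    rw [← this, ← htz, deltaSeq, h, coxExtend_self, ← Perm.mul_apply, mul_inv_cancel_right]
  have hz : ∀ z : Fin (n * k), ∃ v i, z = finProdFinEquiv ((π i)⁻¹ v, i) := fun z => by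
    obtain ⟨x, i, rfl⟩ := exists_finProdFinEquiv z
    exact ⟨π i x, i, by simp⟩
  have hg : ∀ v i, π (finProdFinEquiv ((π i)⁻¹ v, i)).modNat
      (finProdFinEquiv ((π i)⁻¹ v, i)).divNat = v := fun v i => by
    rw [modNat_finProdFinEquiv, divNat_finProdFinEquiv, ← Perm.mul_apply, mul_inv_cancel,
      Perm.one_apply]
  have hbase : ∀ v i, orbits t (finProdFinEquiv ((π ⟨0, hk⟩)⁻¹ v, ⟨0, hk⟩))
      (finProdFinEquiv ((π i)⁻¹ v, i)) := by
    rintro v ⟨i, hi⟩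
    induction i with
    | zero => exact (orbits t).refl' _
    | succ i ih =>
      rw [← hlt ⟨i, by omega⟩ hi v]
      exact (orbits t).trans' (ih (by omega)) (orbits_apply_right _ _)
  have hstep : ∀ v, orbits t (finProdFinEquiv ((π ⟨0, hk⟩)⁻¹ v, ⟨0, hk⟩))
      (finProdFinEquiv (v, ⟨0, hk⟩)) := fun v => by
    have h1 : k - 1 + 1 = k := by omega
    have h2 := hbase v ⟨k - 1, by omega⟩
    rw [← heq ⟨k - 1, by omega⟩ h1 v]
    exact (orbits t).trans' h2 (orbits_apply_right _ _)
  refine le_antisymm (orbits_le_iff.2 fun z => ?_) fun z z' h => ?_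
  · obtain ⟨v, i, rfl⟩ := hz z
    rw [Setoid.comap_rel, hg]
    by_cases h : i.val + 1 < k
    · rw [hlt i h, hg]
    · rw [heq i (by omega), modNat_finProdFinEquiv, divNat_finProdFinEquiv]
      exact orbits_apply_right _ _
  · obtain ⟨v, i, rfl⟩ := hz z
    obtain ⟨v', j, rfl⟩ := hz z'
    rw [Setoid.comap_rel, hg, hg] at h
    have hle : orbits (π ⟨0, hk⟩) ≤ (orbits t).comap
        fun v => finProdFinEquiv ((π ⟨0, hk⟩)⁻¹ v, ⟨0, hk⟩) := by
      rw [orbits_le_iff]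
      intro v
      have := hstep v
      rw [Setoid.comap_rel]
      simpa using this
    exact (orbits t).trans' ((orbits t).symm' (hbase v i)) ((orbits t).trans' (hle h) (hbase v' j))

theorem add_sum_eq_iff_forall_add_eq {f g : ℕ → ℕ} (h : ∀ i, f (i + 1) ≤ f i + g i) (k : ℕ) :
    f k = f 0 + ∑ i ∈ Finset.range k, g i ↔ ∀ i < k, f (i + 1) = f i + g i := by
  have hle : ∀ k, f k ≤ f 0 + ∑ i ∈ Finset.range k, g i := by
    intro k
    induction k with
    | zero => simp
    | succ k ih => rw [Finset.sum_range_succ]; have := h k; omega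
  induction k with
  | zero => simp
  | succ k ih =>
    have h1 := h k
    have h2 := hle k
    rw [Finset.sum_range_succ]
    constructor
    · intro h3 i hi
      rcases Nat.lt_succ_iff_lt_or_eq.1 hi with hi | rfl
      · exact ih.1 (by omega) i hi
      · omega
    · intro h3
      have := ih.2 fun i hi => h3 i (by omega)
      have := h3 k (by omega)
      omega

/-- The shuffle of a delta sequence lies below the Coxeter element if and only if the sequence is
a multichain below the Coxeter element. -/
theorem shufflePerm_deltaSeq_absLE_iff {n k : ℕ} (hn : 0 < n) (hk : 0 < k)
    (π : Fin k → Perm (Fin n)) : AbsLE (shufflePerm (deltaSeq π)) (finRotate (n * k)) ↔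
      ∀ i < k, AbsLE (coxExtend π i) (coxExtend π (i + 1)) := by
  have htop : ∀ m, 0 < m → absLength (finRotate m) + 1 = m := fun m hm => by
    have h := absLength_add_card_orbits (finRotate m)
    rw [(isCyclicSucc_finRotate m).orbits_eq] at h
    have : Nonempty (Fin m) := ⟨⟨0, hm⟩⟩
    have : Subsingleton (Quotient (⊤ : Setoid (Fin m))) := ⟨fun p q => by
      induction p, q using Quotient.inductionOn₂' with | _ x y => exact Quotient.eq''.2 trivial⟩
    rwa [Nat.card_of_subsingleton (Quotient.mk'' (⟨0, hm⟩ : Fin m))] at h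
  have hsurj : Function.Surjective fun z : Fin (n * k) => π z.modNat z.divNat := fun v =>
    ⟨finProdFinEquiv ((π ⟨0, hk⟩)⁻¹ v, ⟨0, hk⟩), by
      simp only [modNat_finProdFinEquiv, divNat_finProdFinEquiv]
      simp⟩
  have h1 := absLength_add_card_orbits (finRotate (n * k) * (shufflePerm (deltaSeq π))⁻¹)
  rw [orbits_finRotate_mul_shufflePerm hk, card_quotient_comap hsurj, absLength_mul_comm] at h1
  have h2 := absLength_add_card_orbits (π ⟨0, hk⟩)
  have h3 := htop n hn
  have h4 := htop (n * k) (Nat.mul_pos hn hk)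
  have h5 := absLength_shufflePerm (deltaSeq π)
  have h6 : ∑ i ∈ Finset.range k, absLength ((coxExtend π i)⁻¹ * coxExtend π (i + 1)) =
      ∑ i, absLength (deltaSeq π i) := by
    rw [Finset.sum_range]
    refine Finset.sum_congr rfl fun i _ => ?_
    rw [coxExtend_of_lt _ i.isLt, deltaSeq]
  have h7 := add_sum_eq_iff_forall_add_eq (f := fun i => absLength (coxExtend π i))
    (g := fun i => absLength ((coxExtend π i)⁻¹ * coxExtend π (i + 1)))
    (fun i => by
      have := absLength_mul_le (coxExtend π i) ((coxExtend π i)⁻¹ * coxExtend π (i + 1))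
      rwa [mul_inv_cancel_left] at this) k
  simp only [h6, coxExtend_self] at h7
  rw [coxExtend_of_lt _ hk] at h7
  unfold AbsLE
  rw [← h7]
  omega

/-! ## Edelman's poset -/

theorem K_le_iff {n : ℕ} (P Q : NC n) : K n P ≤ K n Q ↔ Q ≤ P := by
  change kreweras P.1 ≤ kreweras Q.1 ↔ Q.1 ≤ P.1
  rw [kreweras_eq_aux P.2, kreweras_eq_aux Q.2]
  exact ⟨le_of_krewerasAux_le P.2, fun h x y hxy p q hpq => hxy p q (h hpq)⟩

theorem AbsLE.mul_inv {n : ℕ} {u w : Perm (Fin n)} (h : AbsLE u w) : AbsLE (w * u⁻¹) w := by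
  have h1 : (w * u⁻¹)⁻¹ * w = u := by group
  unfold AbsLE at *
  rw [h1, absLength_mul_comm, h, add_comm]

theorem K_symm_orbits {n : ℕ} {w : Perm (Fin n)} (hw : AbsLE w (finRotate n)) :
    (K n).symm ⟨orbits w, isNoncrossing_orbits hw⟩ =
      ⟨orbits (finRotate n * w⁻¹), isNoncrossing_orbits hw.mul_inv⟩ := by
  rw [Equiv.symm_apply_eq]
  refine Subtype.ext ?_
  have h := (isCyclicSucc_of_absLE_finRotate hw.mul_inv).kreweras (isNoncrossing_orbits hw.mul_inv)
  have h1 : (finRotate n * w⁻¹)⁻¹ * finRotate n = w := by group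
  rw [h1] at h
  exact h.orbits_eq

theorem isKDivisible_comap {n k : ℕ} (R : Setoid (Fin n)) (π : Fin k → Perm (Fin n)) :
    IsKDivisible k (R.comap fun z : Fin (n * k) => π z.modNat z.divNat) := by
  rintro B ⟨z, rfl⟩
  let E : Fin (n * k) ≃ Fin n × Fin k := finProdFinEquiv.symm.trans (Equiv.prodCongrLeft π)
  have hB : {x | (R.comap fun z : Fin (n * k) => π z.modNat z.divNat) x z} =
      E ⁻¹' ({y | R y (π z.modNat z.divNat)} ×ˢ Set.univ) := by
    ext x
    change _ ↔ R _ _ ∧ True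
    rw [and_true]
    rfl
  rw [hB, Set.ncard_preimage_of_injective_subset_range E.injective
    (by rw [E.surjective.range_eq]; exact Set.subset_univ _), Set.ncard_prod, Set.ncard_univ]
  simp

theorem IsKDivisible.dvd_card {n k : ℕ} {P : Setoid (Fin n)} (hP : IsKDivisible k P)
    {S : Finset (Fin n)} (hS : ∀ p q, P p q → p ∈ S → q ∈ S) : k ∣ S.card := by
  classical
  rw [Finset.card_eq_sum_card_image (fun x => (Quotient.mk'' x : Quotient P)) S]
  refine Finset.dvd_sum fun q hq => ?_
  obtain ⟨x, hx, rfl⟩ := Finset.mem_image.1 hq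
  have hB : {y | P y x} =
      ↑(S.filter fun y => (Quotient.mk'' y : Quotient P) = Quotient.mk'' x) := by
    ext y
    simp only [Finset.coe_filter, Set.mem_ofPred_eq]
    exact ⟨fun h => ⟨hS x y (P.symm' h) hx, Quotient.eq''.2 h⟩, fun h => Quotient.eq''.1 h.2⟩
  rw [← Set.ncard_coe_finset, ← hB]
  exact hP _ (P.mem_classes x)

/-- In a `k`-divisible noncrossing partition the residue modulo `k` increases by one from each
element to its cyclic successor. -/
theorem IsCyclicSucc.modEq {n k : ℕ} {P : Setoid (Fin n)} {w : Perm (Fin n)}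
    (h : IsCyclicSucc P w) (hP : IsNoncrossing P) (hd : IsKDivisible k P) (z : Fin n) :
    (w z).val ≡ z.val + 1 [MOD k] := by
  rcases lt_or_ge z (w z) with hz | hz
  · have h1 := hd.dvd_card (S := Finset.Ioo z (w z)) fun p q hpq hp => by
      rw [Finset.mem_Ioo] at *
      exact h.between hP hpq hp.1 hp.2
    rw [Fin.card_Ioo, Nat.sub_sub] at h1
    exact ((Nat.modEq_iff_dvd' hz).2 h1).symm
  · have h1 := hd.dvd_card (S := Finset.Icc (w z) z) fun p q hpq hp => by
      rw [Finset.mem_Icc] at *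
      exact h.between_of_le hP hz hpq hp.1 hp.2
    rw [Fin.card_Icc] at h1
    exact (Nat.modEq_iff_dvd' (le_trans hz (Nat.le_succ _))).2 h1

theorem exists_shufflePerm_eq {n k : ℕ} (s : Perm (Fin (n * k)))
    (hs : ∀ z, (s z).modNat = z.modNat) : ∃ δ, shufflePerm δ = s := by
  have hz : ∀ x i, s (finProdFinEquiv (x, i)) =
      finProdFinEquiv ((s (finProdFinEquiv (x, i))).divNat, i) := fun x i => by
    have h := hs (finProdFinEquiv (x, i))
    rw [modNat_finProdFinEquiv] at h
    obtain ⟨y, j, hy⟩ := exists_finProdFinEquiv (s (finProdFinEquiv (x, i)))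
    rw [hy, modNat_finProdFinEquiv] at h
    rw [hy, divNat_finProdFinEquiv, h]
  have hinj : ∀ i, Function.Injective fun x => (s (finProdFinEquiv (x, i))).divNat := by
    intro i x y hxy
    have h := (hz x i).trans ((congrArg (fun v => finProdFinEquiv (v, i)) hxy).trans (hz y i).symm)
    exact congrArg Prod.fst (finProdFinEquiv.injective (s.injective h))
  refine ⟨fun i => Equiv.ofBijective _ (hinj i).bijective_of_finite, Equiv.ext fun z => ?_⟩
  obtain ⟨x, i, rfl⟩ := exists_finProdFinEquiv z
  rw [shufflePerm_apply]
  exact (hz x i).symm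

theorem finRotate_modEq {n k : ℕ} (hk : k ∣ n) (z : Fin n) :
    (finRotate n z).val ≡ z.val + 1 [MOD k] := by
  rw [val_finRotate]
  split_ifs with h
  · rw [h]
    exact ((Nat.modEq_zero_iff_dvd).2 hk).symm
  · rfl

/-! ## Multichains of permutations -/

theorem absLE_coxExtend {n k : ℕ} {π : Fin k → Perm (Fin n)}
    (h : ∀ i < k, AbsLE (coxExtend π i) (coxExtend π (i + 1))) {i j : ℕ} (hij : i ≤ j)
    (hj : j ≤ k) : AbsLE (coxExtend π i) (coxExtend π j) := by
  induction j, hij using Nat.le_induction with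
  | base => exact AbsLE.refl _
  | succ j _ ih => exact (ih (by omega)).trans (h j hj)

namespace KDivSym

variable {n k : ℕ}

/-- The multichain of permutations given by a sequence whose consecutive terms are comparable. -/
def ofSteps (π : Fin k → Perm (Fin n))
    (h : ∀ i < k, AbsLE (coxExtend π i) (coxExtend π (i + 1))) : KDivSym k n where
  perm := π
  mem i := ⟨one_absLE _, by
    have := absLE_coxExtend h i.isLt.le le_rfl
    rwa [coxExtend_self, coxExtend_of_lt _ i.isLt] at this⟩
  chain i j hij := by
    have := absLE_coxExtend h (Fin.le_def.1 hij) j.isLt.le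
    rwa [coxExtend_of_lt _ i.isLt, coxExtend_of_lt _ j.isLt] at this

theorem step (π : KDivSym k n) (i : Fin k) :
    AbsLE (π.perm i) (coxExtend π.perm (i.val + 1)) := by
  by_cases h : i.val + 1 < k
  · rw [coxExtend_of_lt _ h]
    exact π.chain _ _ (Fin.le_def.2 (Nat.le_succ _))
  · obtain h : i.val + 1 = k := by omega
    rw [h, coxExtend_self]
    exact (π.mem i).2

theorem coxExtend_absLE_finRotate (π : KDivSym k n) (i : ℕ) :
    AbsLE (coxExtend π.perm i) (finRotate n) := by
  unfold coxExtend
  split_ifs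
  · exact (π.mem _).2
  · exact AbsLE.refl _

theorem delta_absLE_finRotate (π : KDivSym k n) (i : Fin k) :
    AbsLE (π.delta i) (finRotate n) := by
  rw [delta_eq_deltaSeq]
  exact (π.step i).inv_mul.trans (π.coxExtend_absLE_finRotate _)

theorem shufflePerm_delta_absLE (π : KDivSym k n) (hn : 0 < n) (hk : 0 < k) :
    AbsLE (shufflePerm π.delta) (finRotate (n * k)) := by
  rw [delta_eq_deltaSeq, shufflePerm_deltaSeq_absLE_iff hn hk]
  intro i hi
  rw [coxExtend_of_lt _ hi]
  exact π.step ⟨i, hi⟩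

theorem isNoncrossing_orbitSeq (π : KDivSym k n) (i : Fin k) : IsNoncrossing (π.orbitSeq i) :=
  isNoncrossing_orbits (π.mem i).2

theorem monotone_orbitSeq (π : KDivSym k n) : Monotone π.orbitSeq :=
  fun i j hij => (π.chain i j hij).orbits_le

theorem orbits_delta (π : KDivSym k n) :
    (fun i => orbits (π.delta i)) = classicalDelta π.orbitSeq := by
  funext i
  have hs := fun i => isCyclicSucc_of_absLE_finRotate (π.mem i).2
  simp only [delta, classicalDelta]
  split_ifs with h
  · exact ((hs i).relKreweras (hs _) (π.monotone_orbitSeq (Fin.le_def.2 (Nat.le_succ _)))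
      (π.isNoncrossing_orbitSeq i)).orbits_eq
  · exact ((hs i).kreweras (π.isNoncrossing_orbitSeq i)).orbits_eq

theorem shuffle_classicalDelta (π : KDivSym k n) :
    shuffle (classicalDelta π.orbitSeq) = orbits (shufflePerm π.delta) := by
  rw [orbits_shufflePerm, orbits_delta]

theorem isNoncrossing_shuffle (π : KDivSym k n) (hn : 0 < n) (hk : 0 < k) :
    IsNoncrossing (shuffle (classicalDelta π.orbitSeq)) := by
  rw [shuffle_classicalDelta]
  exact isNoncrossing_orbits (π.shufflePerm_delta_absLE hn hk)

theorem K_symm_shuffle (π : KDivSym k n) (hn : 0 < n) (hk : 0 < k) :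
    ((K (n * k)).symm
      ⟨shuffle (classicalDelta π.orbitSeq), π.isNoncrossing_shuffle hn hk⟩).1 =
      orbits (finRotate (n * k) * (shufflePerm π.delta)⁻¹) := by
  refine Eq.trans ?_ (congrArg Subtype.val (K_symm_orbits (π.shufflePerm_delta_absLE hn hk)))
  exact congrArg (fun Q => ((K (n * k)).symm Q).1) (Subtype.ext π.shuffle_classicalDelta)

/-- The map `(π)_k ↦ K⁻¹⟨∂({π})_k⟩`. -/
noncomputable def toEdelman (hn : 0 < n) (hk : 0 < k) (π : KDivSym k n) : EdelmanNC k n :=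
  ⟨(K (n * k)).symm ⟨shuffle (classicalDelta π.orbitSeq), π.isNoncrossing_shuffle hn hk⟩, by
    rw [π.K_symm_shuffle hn hk, delta_eq_deltaSeq, orbits_finRotate_mul_shufflePerm hk]
    exact isKDivisible_comap _ _⟩

theorem toEdelman_le_iff (hn : 0 < n) (hk : 0 < k) (π μ : KDivSym k n) :
    toEdelman hn hk π ≤ toEdelman hn hk μ ↔ π ≤ μ := by
  have h1 : toEdelman hn hk π ≤ toEdelman hn hk μ ↔
      (toEdelman hn hk π).1 ≤ (toEdelman hn hk μ).1 := Iff.rfl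
  rw [h1, ← K_le_iff, toEdelman, toEdelman, Equiv.apply_symm_apply,
    Equiv.apply_symm_apply, Subtype.mk_le_mk, shuffle_le_iff]
  refine forall_congr' fun i => ?_
  rw [absLE_iff_orbits_le (μ.delta_absLE_finRotate i) (π.delta_absLE_finRotate i),
    ← μ.orbits_delta, ← π.orbits_delta]

theorem eq_of_delta_eq {π μ : KDivSym k n} (h : π.delta = μ.delta) : π = μ := by
  rw [delta_eq_deltaSeq, delta_eq_deltaSeq] at h
  have key : ∀ m ≤ k, coxExtend π.perm (k - m) = coxExtend μ.perm (k - m) := by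
    intro m
    induction m with
    | zero => intro _; rw [Nat.sub_zero, coxExtend_self, coxExtend_self]
    | succ m ih =>
      intro hm
      have hlt : k - (m + 1) < k := by omega
      have h1 := congrFun h ⟨k - (m + 1), hlt⟩
      have h2 : k - (m + 1) + 1 = k - m := by omega
      simp only [deltaSeq, h2, ih (by omega)] at h1
      rw [coxExtend_of_lt _ hlt, coxExtend_of_lt _ hlt]
      exact inv_injective (mul_right_cancel h1)
  refine KDivSym.ext (funext fun i => ?_)
  have h1 := key (k - i.val) (Nat.sub_le _ _)
  rwa [Nat.sub_sub_self i.isLt.le, coxExtend_of_lt _ i.isLt, coxExtend_of_lt _ i.isLt] at h1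

theorem toEdelman_injective (hn : 0 < n) (hk : 0 < k) :
    Function.Injective (toEdelman (n := n) (k := k) hn hk) := by
  intro π μ h
  have h1 := (toEdelman_le_iff hn hk π μ).1 h.le
  have h2 := (toEdelman_le_iff hn hk μ π).1 h.ge
  exact eq_of_delta_eq (funext fun i =>
    eq_of_orbits_eq (π.delta_absLE_finRotate i) (μ.delta_absLE_finRotate i)
      (le_antisymm (h2 i).orbits_le (h1 i).orbits_le))

theorem toEdelman_surjective (hn : 0 < n) (hk : 0 < k) :
    Function.Surjective (toEdelman (n := n) (k := k) hn hk) := by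
  rintro ⟨⟨P, hP⟩, hd⟩
  obtain ⟨t, ht⟩ := exists_isCyclicSucc P
  have hmod : ∀ z, ((t⁻¹ * finRotate (n * k)) z).modNat = z.modNat := by
    intro z
    obtain ⟨y, hy⟩ := t.surjective (finRotate (n * k) z)
    have h1 : (t⁻¹ * finRotate (n * k)) z = y := by simp [← hy]
    have h2 := ht.modEq hP hd y
    rw [hy] at h2
    have h3 := (h2.symm.trans (finRotate_modEq (Dvd.intro_left n rfl) z)).add_right_cancel' 1
    rw [h1]
    exact Fin.ext h3
  obtain ⟨δ, hδ⟩ := exists_shufflePerm_eq _ hmod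
  obtain ⟨π, rfl⟩ := exists_deltaSeq_eq δ
  have hle : AbsLE (shufflePerm (deltaSeq π)) (finRotate (n * k)) := by
    rw [hδ]
    exact (ht.absLE_finRotate hP).inv_mul
  refine ⟨ofSteps π ((shufflePerm_deltaSeq_absLE_iff hn hk π).1 hle),
    Subtype.ext (Subtype.ext ?_)⟩
  refine (K_symm_shuffle _ hn hk).trans ?_
  rw [delta_eq_deltaSeq]
  change orbits (_ * (shufflePerm (deltaSeq π))⁻¹) = P
  rw [hδ, ← ht.orbits_eq]
  congr 1
  group

/-- The isomorphism `(π)_k ↦ K⁻¹⟨∂({π})_k⟩` onto Edelman's poset. -/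
noncomputable def edelmanIso (hn : 0 < n) (hk : 0 < k) : KDivSym k n ≃o EdelmanNC k n where
  toEquiv := Equiv.ofBijective _ ⟨toEdelman_injective hn hk, toEdelman_surjective hn hk⟩
  map_rel_iff' := toEdelman_le_iff hn hk _ _

/-- The multichain of orbit partitions. -/
def orbitChain (π : KDivSym k n) : Fin k →o NC n where
  toFun i := ⟨π.orbitSeq i, π.isNoncrossing_orbitSeq i⟩
  monotone' _ _ hij := π.monotone_orbitSeq hij

theorem orbitChain_bijective : Function.Bijective (orbitChain (k := k) (n := n)) := by
  constructor
  · intro π μ h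
    refine KDivSym.ext (funext fun i => eq_of_orbits_eq (π.mem i).2 (μ.mem i).2 ?_)
    exact congrArg Subtype.val (DFunLike.congr_fun h i)
  · intro P
    choose w hw using fun i => exists_isCyclicSucc (P i).1
    refine ⟨⟨w, fun i => ⟨one_absLE _, (hw i).absLE_finRotate (P i).2⟩,
      fun i j hij => (hw i).absLE (hw j) (P.monotone hij) (P i).2⟩, ?_⟩
    exact OrderHom.ext _ _ (funext fun i => Subtype.ext (hw i).orbits_eq)

/-- The bijection `(P)_k ↦ K⁻¹⟨∂(P)_k⟩` from multichains of noncrossing partitions. -/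
noncomputable def chainEquiv (hn : 0 < n) (hk : 0 < k) : (Fin k →o NC n) ≃ EdelmanNC k n :=
  (Equiv.ofBijective _ orbitChain_bijective).symm.trans (edelmanIso hn hk).toEquiv

theorem chainEquiv_orbitChain (hn : 0 < n) (hk : 0 < k) (π : KDivSym k n) :
    chainEquiv hn hk π.orbitChain = toEdelman hn hk π :=
  congrArg (toEdelman hn hk)
    ((Equiv.ofBijective orbitChain orbitChain_bijective).symm_apply_apply π)

end KDivSym

end KDivNC

theorem mainTheorem9 (n k : ℕ) (hn : 0 < n) (hk : 0 < k) :
    -- `({π})_k` is a multichain in `NC(n)`, and `∂({π})_k`, that is, the sequence of orbit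
    -- partitions of the delta sequence `∂(π)_k`, is given by relative Kreweras complements
    (∀ π : KDivSym k n,
      (∀ i, IsNoncrossing (π.orbitSeq i)) ∧ Monotone π.orbitSeq ∧
        (fun i => orbits (π.delta i)) = classicalDelta π.orbitSeq) ∧
    -- `(π)_k ↦ K⁻¹⟨∂({π})_k⟩` is an isomorphism of posets from `NC^{(k)}(A_{n-1})` to `NC^{(k)}(n)`
    (∃ Φ : KDivSym k n ≃o EdelmanNC k n, ∀ π : KDivSym k n,
      ∃ h : IsNoncrossing (shuffle (classicalDelta π.orbitSeq)),
        (Φ π).1 = (K (n * k)).symm ⟨shuffle (classicalDelta π.orbitSeq), h⟩) ∧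
    -- `(P)_k ↦ K⁻¹⟨∂(P)_k⟩` is a bijection from `k`-multichains in `NC(n)` to `NC^{(k)}(n)`
    (∃ Ψ : (Fin k →o NC n) ≃ EdelmanNC k n, ∀ P : Fin k →o NC n,
      ∃ h : IsNoncrossing (shuffle (classicalDelta fun i => (P i).1)),
        (Ψ P).1 = (K (n * k)).symm ⟨shuffle (classicalDelta fun i => (P i).1), h⟩) := by
  refine ⟨fun π => ⟨π.isNoncrossing_orbitSeq, π.monotone_orbitSeq, π.orbits_delta⟩,
    ⟨KDivSym.edelmanIso hn hk, fun π => ⟨π.isNoncrossing_shuffle hn hk, rfl⟩⟩,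
    ⟨KDivSym.chainEquiv hn hk, fun P => ?_⟩⟩
  obtain ⟨π, rfl⟩ := KDivSym.orbitChain_bijective.2 P
  exact ⟨π.isNoncrossing_shuffle hn hk,
    congrArg Subtype.val (KDivSym.chainEquiv_orbitChain hn hk π)⟩
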